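/- Let \(f_1,\dots,f_I:\mathbb R^n\to\mathbb R\) be differentiable (possibly nonconvex), with \(\nabla f_i\) \(L_i\)-Lipschitz for the Euclidean norm, and let \(F=\sum_{i=1}^I f_i\) be bounded below. Let \(\mathcal G=(\mathcal V,\mathcal E)\), \(\mathcal V=\{1,\dots,I\}\), be a strongly connected digraph without self-loops; \((j,i)\in\mathcal E\) means that \(j\) can send to \(i\), \(\mathcal N_i^{\rm in}=\{j:(j,i)\in\mathcal E\}\), \(\mathcal N_i^{\rm out}=\{j:(i,j)\in\mathcal E\}\). Let \(\mathbf W=(w_{ij})\) be row-stochastic and \(\mathbf A=(a_{ij})\) column-stochastic, such that for some \(\bar m>0\) both matrices \(\mathbf M=(m_{ij})\in\{\mathbf W,\mathbf A\}\) satisfy \(m_{ii}\ge\bar m\) for all \(i\), \(m_{ij}\ge\bar m\) for \((j,i)\in\mathcal E\), and \(m_{ij}=0\) otherwise. Let \((i^k)_{k\ge0}\) in \(\mathcal V\) and delays \(d_j^k\in\mathbb N_0\) be such that, for some integers \(T,D>0\) and all \(k\ge 0\), \(\{i^k,\dots,i^{k+T-1}\}=\mathcal V\), and \(0\le d_j^k\le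 D\) for \(j\in\mathcal N^{\rm in}_{i^k}\). ASY-SONATA with constant step \(\gamma\) starts from arbitrary \(\mathbf x_i^0\in\mathbb R^n\), with \(\mathbf z_i^0=\nabla f_i(\mathbf x_i^0)\), \(\tilde{\boldsymbol\rho}_{ij}^0=0\) and \(\tau_{ij}^{-1}=-D\) for \(j\in\mathcal N_i^{\rm in}\), and \(\boldsymbol\rho_{ij}^t=0\), \(\mathbf v_i^t=0\) for \(t=-D,\dots,0\). At iteration \(k=0,1,\dots\), with \(i=i^k\), it sets \[\tau_{ij}^k=\max(\tau_{ij}^{k-1},k-d_j^k)\quad (j\in\mathcal N_i^{\rm in}),\] \[\mathbf v_i^{k+1}=\mathbf x_i^k-\gamma\,\mathbf z_i^k,\qquad \mathbf x_i^{k+1}=w_{ii}\mathbf v_i^{k+1}+\sum_{j\in\mathcal N_i^{\rm in}}w_{ij}\mathbf v_j^{\tau_{ij}^k},\] \[\mathbf z_i^{k+1/2}=\mathbf z_i^k+\sum_{j\in\mathcal N_i^{\rm in}}\bigl(\boldsymbol\rho_{ij}^{\tau_{ij}^k}-\tilde{\boldsymbol\rho}_{ij}^k\bigr)+\nabla f_i(\mathbf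 x_i^{k+1})-\nabla f_i(\mathbf x_i^k),\] \[\mathbf z_i^{k+1}=a_{ii}\mathbf z_i^{k+1/2},\qquad \boldsymbol\rho_{ji}^{k+1}=\boldsymbol\rho_{ji}^k+a_{ji}\mathbf z_i^{k+1/2}\ (j\in\mathcal N_i^{\rm out}),\qquad \tilde{\boldsymbol\rho}_{ij}^{k+1}=\boldsymbol\rho_{ij}^{\tau_{ij}^k}\ (j\in\mathcal N_i^{\rm in}),\] and leaves all other variables unchanged. Put \(\bar{\mathbf x}^k=\frac1I\sum_i\mathbf x_i^k\) and \[M_F(\mathbf x^k)=\max\Bigl\{\|\nabla F(\bar{\mathbf x}^k)\|^2,\ \sum_{i=1}^I\|\mathbf x_i^k-\bar{\mathbf x}^k\|^2\Bigr\},\] and, for \(\delta>0\), let \(T_\delta\) be the first \(k\in\mathbb N_0\) with \(M_F(\mathbf x^k)\le\delta\). Then there is a constant \(\bar\gamma_2>0\), depending only on \(\mathcal G\), \(\bar m\), \((L_i)_i\), \(T\) and \(D\), such that for every constant step \(0<\gamma\le\bar\gamma_2\) one has \(T_\delta=\mathcal O(1/\delta)\): there is a constant \(C\), depending only on these data and on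 \(n\), \((f_i)_i\), \((\mathbf x_i^0)_i\) and \(\gamma\) (not on \(\delta\), on the weights, or on the activations and delays), such that for every \(\delta>0\) the iteration \(T_\delta\) exists and \(T_\delta\le C/\delta\). -/

import Mathlib

noncomputable section

namespace AsySonata

/-- In-neighbours of `i`: the nodes `j` with `(j, i)` an edge (`G.Adj j i`: `j` can send to `i`). -/
def inNbrs {V : Type*} [Fintype V] (G : Digraph V) (i : V) : Finset V :=
  open Classical in Finset.univ.filter (fun j => G.Adj j i)

/-- Every node can be reached from every other node along directed edges. -/
def StronglyConnected {V : Type*} (G : Digraph V) : Prop :=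
  ∀ i j : V, Relation.ReflTransGen G.Adj i j

/-- The weight matrix `M` is compliant with the digraph, with its prescribed entries at least
`m`: positive on the diagonal and on the edges, zero elsewhere. -/
structure Compliant {V : Type*} (G : Digraph V) (m : ℝ) (M : Matrix V V ℝ) : Prop where
  diag : ∀ i, m ≤ M i i
  edge : ∀ i j, G.Adj j i → m ≤ M i j
  zero : ∀ i j, i ≠ j → ¬ G.Adj j i → M i j = 0

/-- Every row sums to one. -/
def RowStochastic {V : Type*} [Fintype V] (M : Matrix V V ℝ) : Prop :=
  ∀ i, ∑ j, M i j = 1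

/-- Every column sums to one. -/
def ColStochastic {V : Type*} [Fintype V] (M : Matrix V V ℝ) : Prop :=
  ∀ j, ∑ i, M i j = 1

/-- The asynchronous model: `act k` is the agent completing its update at iteration `k`, and
`d k j` is the delay of the information it uses from its in-neighbour `j`. Every agent is active
in every window of `T` consecutive iterations, and the delays are at most `D`. -/
structure AsyncModel {V : Type*} (G : Digraph V) (T D : ℕ) (act : ℕ → V) (d : ℕ → V → ℕ) :
    Prop where
  active : ∀ (k : ℕ) (i : V), ∃ t, k ≤ t ∧ t < k + T ∧ act t = i
  delay : ∀ (k : ℕ) (j : V), G.Adj j (act k) → d k j ≤ D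

/-- The sum cost `F = ∑ i, f i`. -/
def total {V : Type*} [Fintype V] {n : ℕ} (f : V → EuclideanSpace ℝ (Fin n) → ℝ) :
    EuclideanSpace ℝ (Fin n) → ℝ :=
  fun y => ∑ i, f i y

/-- The variables of ASY-SONATA along the iterations. Variables that are read with a delay are
indexed by `ℤ`, since their values at the times `-D, …, 0` are part of the initial data; `τ` is
indexed from `-1`. For an edge `(j, i)`, the quantities on that edge are written with the receiver
first: `ρ t i j`, `ρt k i j`, `τ t i j`. -/
structure Variables (V : Type*) (n : ℕ) where
  /-- local copies `x_i^k` of the optimization variable -/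
  x : ℕ → V → EuclideanSpace ℝ (Fin n)
  /-- intermediate variables `v_i^t` -/
  v : ℤ → V → EuclideanSpace ℝ (Fin n)
  /-- tracking variables `z_i^k` -/
  z : ℕ → V → EuclideanSpace ℝ (Fin n)
  /-- intermediate mass `z_{i^k}^{k+1/2}` of the agent active at iteration `k` -/
  zHalf : ℕ → EuclideanSpace ℝ (Fin n)
  /-- cumulative masses `ρ_{ij}^t` -/
  ρ : ℤ → V → V → EuclideanSpace ℝ (Fin n)
  /-- mass buffers, `ρ_{ij}^k` with a tilde -/
  ρt : ℕ → V → V → EuclideanSpace ℝ (Fin n)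
  /-- time stamps `τ_{ij}^t` -/
  τ : ℤ → V → V → ℤ

/-- The variables `s` are generated by ASY-SONATA on the digraph `G`, with costs `f`, consensus
weights `W`, push weights `A`, delay bound `D`, step sizes `γ`, activations `act`, delays `d` and
initial points `x₀`. -/
structure Generated {V : Type*} [Fintype V] {n : ℕ} (G : Digraph V)
    (f : V → EuclideanSpace ℝ (Fin n) → ℝ) (W A : Matrix V V ℝ) (D : ℕ) (γ : ℕ → ℝ)
    (act : ℕ → V) (d : ℕ → V → ℕ) (x₀ : V → EuclideanSpace ℝ (Fin n))
    (s : Variables V n) : Prop where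
  -- initial data
  x_init : ∀ i, s.x 0 i = x₀ i
  z_init : ∀ i, s.z 0 i = gradient (f i) (x₀ i)
  v_init : ∀ (t : ℤ) (i : V), -(D : ℤ) ≤ t → t ≤ 0 → s.v t i = 0
  ρ_init : ∀ (t : ℤ) (i j : V), G.Adj j i → -(D : ℤ) ≤ t → t ≤ 0 → s.ρ t i j = 0
  ρt_init : ∀ i j, G.Adj j i → s.ρt 0 i j = 0
  τ_init : ∀ i j, G.Adj j i → s.τ (-1) i j = -(D : ℤ)
  -- purge out the old information
  purge : ∀ (k : ℕ) (j : V), G.Adj j (act k) →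
    s.τ k (act k) j = max (s.τ ((k : ℤ) - 1) (act k) j) ((k : ℤ) - (d k j : ℤ))
  -- local descent
  descent : ∀ k : ℕ, s.v ((k : ℤ) + 1) (act k) = s.x k (act k) - γ k • s.z k (act k)
  -- consensus
  consensus : ∀ k : ℕ, s.x (k + 1) (act k) =
    W (act k) (act k) • s.v ((k : ℤ) + 1) (act k)
      + ∑ j ∈ inNbrs G (act k), W (act k) j • s.v (s.τ k (act k) j) j
  -- gradient tracking: sum step
  sumStep : ∀ k : ℕ, s.zHalf k = s.z k (act k)
    + ∑ j ∈ inNbrs G (act k), (s.ρ (s.τ k (act k) j) (act k) j - s.ρt k (act k) j)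
    + (gradient (f (act k)) (s.x (k + 1) (act k)) - gradient (f (act k)) (s.x k (act k)))
  -- gradient tracking: push step
  push_z : ∀ k : ℕ, s.z (k + 1) (act k) = A (act k) (act k) • s.zHalf k
  push_ρ : ∀ (k : ℕ) (j : V), G.Adj (act k) j →
    s.ρ ((k : ℤ) + 1) j (act k) = s.ρ k j (act k) + A j (act k) • s.zHalf k
  -- gradient tracking: mass-buffer update
  buffer : ∀ (k : ℕ) (j : V), G.Adj j (act k) →
    s.ρt (k + 1) (act k) j = s.ρ (s.τ k (act k) j) (act k) j
  -- untouched variables keep their values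
  x_keep : ∀ (k : ℕ) (i : V), i ≠ act k → s.x (k + 1) i = s.x k i
  v_keep : ∀ (k : ℕ) (i : V), i ≠ act k → s.v ((k : ℤ) + 1) i = s.v k i
  z_keep : ∀ (k : ℕ) (i : V), i ≠ act k → s.z (k + 1) i = s.z k i
  ρ_keep : ∀ (k : ℕ) (i j : V), G.Adj j i → j ≠ act k → s.ρ ((k : ℤ) + 1) i j = s.ρ k i j
  ρt_keep : ∀ (k : ℕ) (i j : V), G.Adj j i → i ≠ act k → s.ρt (k + 1) i j = s.ρt k i j
  τ_keep : ∀ (k : ℕ) (i j : V), G.Adj j i → i ≠ act k → s.τ k i j = s.τ ((k : ℤ) - 1) i j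

/-- The average of the local copies. -/
def average {V : Type*} [Fintype V] {n : ℕ} (x : V → EuclideanSpace ℝ (Fin n)) :
    EuclideanSpace ℝ (Fin n) :=
  (1 / (Fintype.card V : ℝ)) • ∑ i, x i

/-- The merit function: the larger of the squared norm of the gradient of `F` at the average and
the squared Euclidean norm of the stacked consensus error. -/
def merit {V : Type*} [Fintype V] {n : ℕ} (f : V → EuclideanSpace ℝ (Fin n) → ℝ)
    (x : V → EuclideanSpace ℝ (Fin n)) : ℝ :=
  max (‖gradient (total f) (average x)‖ ^ 2) (∑ i, ‖x i - average x‖ ^ 2)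

end AsySonata

end

/-!
The iteration bound follows from a bound on `∑ k < N, merit f (x^k)` that is uniform in `N`
(`exists_isLeast_le_div`). The merit is controlled by three sequences: the norm `a k` of the
tracking variable `z` of the active agent, the disagreement `σ k` of the agents, and the error `t k` of `z` as
a multiple of the sum of the local gradients.

Both error bounds come from finite-dimensional linear systems with stochastic matrices. The delays
are absorbed by additional nodes: old copies of the `v_j` for the consensus step
(`consensusMatrix`, row-stochastic), and packets of mass in transit, sorted by age, for the push-sum
step (`trackingMatrix`, column-stochastic). Strong connectivity, bounded delays and the activation
of every agent within `T` steps bound the influence of any agent, respectively the share of any mass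
reaching any agent, from below over windows of a fixed length (`exists_reach_consensus`,
`exists_reach_tracking`). Hence averaging contracts oscillations geometrically
(`mulVec_sub_mulVec_le`), and by variation of constants (`solution_eq`) the errors are geometrically
`fading` memories of the inputs: `γ a` for `σ` (`exists_consensus_bound`) and the increments of the
gradients, of size `O(σ + γ a)`, for `t` (`exists_tracking_bound`).

For the descent one needs a point `w k` near all local copies that is moved by the steps `γ z` only,
with a weight bounded below. It is the mean of the nodes weighted by their influence on one node at
a later time (`exists_mean_of_rowStochastic`); taking that time finite, beyond the horizon `N` of
the summation, avoids limits of products of matrices. Likewise the share `ξ` of the total mass held by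
an agent is an entry of a finite product (`exists_share`).

Along `w` the function `F` decreases by a multiple of `γ (a k)²`, up to `O(γ (σ² + t²) + γ² a²)`
(`descent_step`). Fading memories preserve square-summability (`sum_fading_sq_le`), so that
`∑ σ² + t²` is at most a constant plus `O(γ²) ∑ a²`, and for small `γ` the descent absorbs this
(`energy_bound`). The threshold for `γ` involves only the gains in these estimates, which depend on
the digraph, `m`, `T`, `D` and the Lipschitz constants; the functions and the initial points enter
through additive constants.
-/

namespace AsySonata
open Matrix Finset

/-! ### Products of stochastic matrices -/

section Products

variable {Ω : Type*} [Fintype Ω] [DecidableEq Ω] {M : ℕ → Matrix Ω Ω ℝ}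

/-- The transition matrix `M (l + j - 1) * ⋯ * M (l + 1) * M l` over the `j` steps from time `l`. -/
def window (M : ℕ → Matrix Ω Ω ℝ) (l : ℕ) : ℕ → Matrix Ω Ω ℝ
  | 0 => 1
  | j + 1 => M (l + j) * window M l j

theorem window_add (M : ℕ → Matrix Ω Ω ℝ) (l i j : ℕ) :
    window M l (i + j) = window M (l + i) j * window M l i := by
  induction j with
  | zero => simp [window]
  | succ j ih => rw [← add_assoc, window, ih, window, ← add_assoc, Matrix.mul_assoc]

theorem window_mem (S : Submonoid (Matrix Ω Ω ℝ)) (hM : ∀ k, M k ∈ S) (l j : ℕ) :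
    window M l j ∈ S := by
  induction j with
  | zero => exact S.one_mem
  | succ j ih => exact S.mul_mem (hM _) ih

/-- The weight with which node `b` at time `l` enters node `c` at time `t` is at least
`m ^ (t - l)`, as it is when some walk in space-time from `b` to `c` uses only weights `≥ m`. -/
def Reaches (M : ℕ → Matrix Ω Ω ℝ) (m : ℝ) (l : ℕ) (b : Ω) (t : ℕ) (c : Ω) : Prop :=
  m ^ (t - l) ≤ window M l (t - l) c b

theorem Reaches.refl (M : ℕ → Matrix Ω Ω ℝ) (m : ℝ) (l : ℕ) (b : Ω) : Reaches M m l b l b := by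
  simp [Reaches, window]

theorem Reaches.step (hM : ∀ k a b, 0 ≤ M k a b) {m : ℝ} (hm : 0 ≤ m) {l t : ℕ} (hlt : l ≤ t)
    {b c c' : Ω} (h : Reaches M m l b t c) (hc : m ≤ M t c' c) :
    Reaches M m l b (t + 1) c' := by
  have hw : ∀ j a a', 0 ≤ window M l j a a' := by
    intro j
    induction j with
    | zero =>
      intro a a'
      rw [window, Matrix.one_apply]
      split_ifs <;> norm_num
    | succ j ih =>
      intro a a'
      rw [window, Matrix.mul_apply]
      exact sum_nonneg fun c _ => mul_nonneg (hM _ _ _) (ih _ _)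
  unfold Reaches at *
  rw [Nat.succ_sub hlt, pow_succ', window, Matrix.mul_apply, Nat.add_sub_cancel' hlt]
  calc m * m ^ (t - l) ≤ M t c' c * window M l (t - l) c b :=
        mul_le_mul hc h (pow_nonneg hm _) (hM _ _ _)
    _ ≤ _ := single_le_sum (f := fun x => M t c' x * window M l (t - l) x b)
        (fun x _ => mul_nonneg (hM _ _ _) (hw _ _ _)) (mem_univ c)

/-- Averaging shrinks the oscillation of a vector by the factor `1 - η` when all the averages give
weight at least `η` to one common entry. -/
theorem mulVec_sub_mulVec_le {R : Matrix Ω Ω ℝ} (hR : R ∈ rowStochastic ℝ Ω) {η : ℝ} {r : Ω}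
    (hr : ∀ a, η ≤ R a r) {u : Ω → ℝ} {c : ℝ} (hu : ∀ a b, u a - u b ≤ c) (a b : Ω) :
    (R *ᵥ u) a - (R *ᵥ u) b ≤ (1 - η) * c := by
  have : Nonempty Ω := ⟨r⟩
  obtain ⟨p, hp⟩ := Finite.exists_max u
  obtain ⟨q, hq⟩ := Finite.exists_min u
  have hη : η ≤ 1 := (hr r).trans (le_one_of_mem_rowStochastic hR)
  have h1 : η * (u p - u r) ≤ u p - (R *ᵥ u) a := by
    have e : u p - (R *ᵥ u) a = ∑ x, R a x * (u p - u x) := by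
      simp [mul_sub, ← Finset.sum_mul, sum_row_of_mem_rowStochastic hR, Matrix.mulVec, dotProduct]
    rw [e]
    exact (mul_le_mul_of_nonneg_right (hr a) (sub_nonneg.2 (hp r))).trans
      (single_le_sum (f := fun x => R a x * (u p - u x))
        (fun x _ => mul_nonneg (nonneg_of_mem_rowStochastic hR) (sub_nonneg.2 (hp x)))
        (mem_univ r))
  have h2 : η * (u r - u q) ≤ (R *ᵥ u) b - u q := by
    have e : (R *ᵥ u) b - u q = ∑ x, R b x * (u x - u q) := by
      simp [mul_sub, ← Finset.sum_mul, sum_row_of_mem_rowStochastic hR, Matrix.mulVec, dotProduct]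
    rw [e]
    exact (mul_le_mul_of_nonneg_right (hr b) (sub_nonneg.2 (hq r))).trans
      (single_le_sum (f := fun x => R b x * (u x - u q))
        (fun x _ => mul_nonneg (nonneg_of_mem_rowStochastic hR) (sub_nonneg.2 (hq x)))
        (mem_univ r))
  have h3 := mul_le_mul_of_nonneg_left (hu p q) (sub_nonneg.2 hη)
  linarith

/-- If node `r` influences all nodes within `K` steps, then the nodes come to depend on the past in
the same way. -/
theorem window_col_sub_le (hM : ∀ k, M k ∈ rowStochastic ℝ Ω) {η : ℝ} {K : ℕ} {r : Ω}
    (hr : ∀ l a, η ≤ window M l K a r) (l j : ℕ) (a a' b : Ω) :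
    window M l j a b - window M l j a' b ≤ (1 - η) ^ (j / K) := by
  have key : ∀ q i a a', window M l (i + K * q) a b - window M l (i + K * q) a' b ≤
      (1 - η) ^ q := by
    intro q
    induction q with
    | zero =>
      intro i a a'
      have hw := window_mem _ hM l (i + K * 0)
      have h1 := le_one_of_mem_rowStochastic hw (i := a) (j := b)
      have h2 := nonneg_of_mem_rowStochastic hw (i := a') (j := b)
      rw [pow_zero]
      linarith
    | succ q ih =>
      intro i a a'
      rw [Nat.mul_succ, ← add_assoc, window_add, pow_succ']
      exact mulVec_sub_mulVec_le (window_mem _ hM (l + (i + K * q)) K) (hr _)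
        (u := fun c => window M l (i + K * q) c b) (ih i) a a'
  have := key (j / K) (j % K) a a'
  rwa [Nat.mod_add_div] at this

/-- If node `r` receives a share of every mass within `K` steps, then the share of a mass that ends
up at node `a` comes to be independent of where the mass started: the rows of the transition
matrices are averaged by the transposes of the matrices at earlier times. -/
theorem window_row_sub_le (hM : ∀ k, M k ∈ colStochastic ℝ Ω) {η : ℝ} {K : ℕ} {r : Ω}
    (hr : ∀ l b, η ≤ window M l K r b) (l j : ℕ) (a b b' : Ω) :
    window M l j a b - window M l j a b' ≤ (1 - η) ^ (j / K) := by
  have key : ∀ q i l b b', window M l (K * q + i) a b - window M l (K * q + i) a b' ≤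
      (1 - η) ^ q := by
    intro q
    induction q with
    | zero =>
      intro i l b b'
      have hw := window_mem _ hM l (K * 0 + i)
      have h1 := le_one_of_mem_colStochastic hw (i := b) (j := a)
      have h2 := nonneg_of_mem_colStochastic hw (i := a) (j := b')
      rw [pow_zero]
      linarith
    | succ q ih =>
      intro i l b b'
      rw [show K * (q + 1) + i = K + (K * q + i) by ring, window_add, pow_succ']
      have := mulVec_sub_mulVec_le
        (transpose_mem_rowStochastic_iff_mem_colStochastic.2 (window_mem _ hM l K))
        (r := r) (fun b => hr l b)
        (u := fun c => window M (l + K) (K * q + i) a c) (ih i (l + K)) b b'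
      simpa [Matrix.mulVec, Matrix.mul_apply, dotProduct, mul_comm] using this
  have := key (j / K) (j % K) l b b'
  rwa [add_comm, Nat.mod_add_div] at this

/-- The factor `1 - η` gained once per `K` steps amounts to a geometric rate per step. -/
theorem exists_geometric_bound {η : ℝ} (h0 : 0 < η) (h1 : η < 1) {K : ℕ} (hK : 0 < K) :
    ∃ C ρ : ℝ, 0 < C ∧ 0 < ρ ∧ ρ < 1 ∧ ∀ j : ℕ, (1 - η) ^ (j / K) ≤ C * ρ ^ j := by
  have hK' : (1 : ℝ) ≤ K := by exact_mod_cast hK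
  have hle : η / K ≤ η := div_le_self h0.le hK'
  have hpos : 0 < η / K := by positivity
  have hρ : 0 < 1 - η / K := by linarith
  refine ⟨((1 - η / K) ^ K)⁻¹, 1 - η / K, by positivity, hρ, by linarith, fun j => ?_⟩
  have hb : 1 - η ≤ (1 - η / K) ^ K := by
    have := one_add_mul_le_pow (a := -(η / K)) (by linarith) K
    rw [← sub_eq_add_neg] at this
    refine le_trans (le_of_eq ?_) this
    field_simp
    ring
  rw [inv_mul_eq_div, le_div_iff₀ (by positivity)]
  calc (1 - η) ^ (j / K) * (1 - η / K) ^ K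
      ≤ ((1 - η / K) ^ K) ^ (j / K) * (1 - η / K) ^ (j % K) := by
        refine mul_le_mul (pow_le_pow_left₀ (by linarith) hb _) ?_ (by positivity) (by positivity)
        exact pow_le_pow_of_le_one hρ.le (by linarith) (Nat.mod_lt _ hK).le
    _ = (1 - η / K) ^ j := by rw [← pow_mul, ← pow_add, Nat.div_add_mod]

variable {E : Type*} [NormedAddCommGroup E] [NormedSpace ℝ E]

/-- Variation of constants for a linear recursion driven at one node per step. -/
theorem solution_eq {y : ℕ → Ω → E} {p : ℕ → Ω} {δ : ℕ → E}
    (h : ∀ k a, y (k + 1) a = ∑ b, M k a b • (y k b + Pi.single (M := fun _ => E) (p k) (δ k) b))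
    (k : ℕ) (a : Ω) :
    y k a = ∑ b, window M 0 k a b • y 0 b
      + ∑ l ∈ range k, window M l (k - l) a (p l) • δ l := by
  induction k generalizing a with
  | zero => simp [window, Matrix.one_apply]
  | succ k ih =>
    have hs : ∀ l ∈ range k, window M l (k + 1 - l) a (p l) • δ l
        = ∑ b, M k a b • window M l (k - l) b (p l) • δ l := by
      intro l hl
      have hl' := (mem_range.1 hl).le
      rw [Nat.succ_sub hl', window, Matrix.mul_apply, Nat.add_sub_cancel' hl', sum_smul]
      simp only [mul_smul]
    have hk : window M k (k + 1 - k) a (p k) • δ k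
        = ∑ b, M k a b • Pi.single (M := fun _ => E) (p k) (δ k) b := by
      rw [Nat.add_sub_cancel_left, Finset.sum_eq_single (p k)]
      · simp [window]
      · intro b _ hb
        simp [hb]
      · simp
    have h0 : ∑ b, window M 0 (k + 1) a b • y 0 b
        = ∑ b, M k a b • ∑ c, window M 0 k b c • y 0 c := by
      simp only [window, Matrix.mul_apply, sum_smul, smul_sum, mul_smul, zero_add]
      rw [sum_comm]
    rw [h, sum_range_succ, hk, sum_congr rfl hs, h0, sum_comm, ← add_assoc, ← sum_add_distrib,
      ← sum_add_distrib]
    refine sum_congr rfl fun b _ => ?_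
    rw [ih b, smul_add, smul_add, smul_sum (s := range k)]

/-- A geometrically fading memory of an initial size `S` and of the inputs `β l`, `l < k`. -/
def fading (C ρ S : ℝ) (β : ℕ → ℝ) (k : ℕ) : ℝ :=
  C * ρ ^ k * S + ∑ l ∈ range k, C * ρ ^ (k - l) * β l

/-- All nodes of a driven averaging system approach each other, up to a geometrically fading memory
of the initial data and of the inputs. -/
theorem norm_sub_le_of_rowStochastic (hM : ∀ k, M k ∈ rowStochastic ℝ Ω) {η : ℝ} {K : ℕ} {r : Ω}
    (hr : ∀ l a, η ≤ window M l K a r) {C ρ : ℝ} (hC : ∀ j : ℕ, (1 - η) ^ (j / K) ≤ C * ρ ^ j)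
    {y : ℕ → Ω → E} {p : ℕ → Ω} {δ : ℕ → E}
    (h : ∀ k a, y (k + 1) a = ∑ b, M k a b • (y k b + Pi.single (M := fun _ => E) (p k) (δ k) b))
    (k : ℕ) (a a' : Ω) :
    ‖y k a - y k a'‖ ≤ fading C ρ (∑ b, ‖y 0 b‖) (fun l => ‖δ l‖) k := by
  have hosc : ∀ l j b, |window M l j a b - window M l j a' b| ≤ C * ρ ^ j := fun l j b =>
    abs_le.2 ⟨by linarith [window_col_sub_le hM hr l j a' a b, hC j],
      (window_col_sub_le hM hr l j a a' b).trans (hC j)⟩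
  have e : y k a - y k a' = ∑ b, (window M 0 k a b - window M 0 k a' b) • y 0 b
      + ∑ l ∈ range k, (window M l (k - l) a (p l) - window M l (k - l) a' (p l)) • δ l := by
    rw [solution_eq h k a, solution_eq h k a']
    simp only [sub_smul, sum_sub_distrib]
    abel
  rw [e, fading]
  refine (norm_add_le _ _).trans (add_le_add ?_ ?_)
  · rw [mul_sum]
    refine norm_sum_le_of_le _ fun b _ => ?_
    rw [norm_smul, Real.norm_eq_abs]
    exact mul_le_mul_of_nonneg_right (hosc _ _ _) (norm_nonneg _)
  · refine norm_sum_le_of_le _ fun l _ => ?_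
    rw [norm_smul, Real.norm_eq_abs]
    exact mul_le_mul_of_nonneg_right (hosc _ _ _) (norm_nonneg _)

/-- In a column-stochastic system, the entries of row `r` of the transition matrices to time `k`
are all close to one number `ξ`, bounded below: node `r` holds at time `k` about the same
share `ξ` of every mass injected long before. -/
theorem exists_share (hM : ∀ k, M k ∈ colStochastic ℝ Ω) {η : ℝ} (hη0 : 0 ≤ η) (hη1 : η ≤ 1)
    {K : ℕ} {r : Ω}
    (hr : ∀ l b, η ≤ window M l K r b) {C ρ : ℝ} (hC : ∀ j : ℕ, (1 - η) ^ (j / K) ≤ C * ρ ^ j)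
    (k : ℕ) :
    ∃ ξ : ℝ, η ≤ ξ ∧ ξ ≤ 1 ∧
      ∀ l ≤ k, ∀ b, |window M l (k - l) r b - ξ| ≤ C * ρ ^ (k - l) := by
  have hle : ∀ l j b, window M l j r b ≤ 1 := fun l j b =>
    le_one_of_mem_colStochastic (window_mem _ hM l j)
  have hge : ∀ l j a b, 0 ≤ window M l j a b := fun l j a b =>
    nonneg_of_mem_colStochastic (window_mem _ hM l j)
  by_cases hk : k < K
  · -- Before time `K` the bound holds for every `ξ ∈ [0, 1]`, its right-hand side being `≥ 1`.
    refine ⟨η, le_rfl, hη1, fun l hl b => ?_⟩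
    have h1 := hC (k - l)
    rw [Nat.div_eq_of_lt (by omega), pow_zero] at h1
    refine le_trans (abs_le.2 ⟨?_, ?_⟩) h1
    · linarith [hge l (k - l) r b]
    · linarith [hle l (k - l) b]
  · push Not at hk
    refine ⟨window M 0 k r r, ?_, hle _ _ _, fun l hl b => ?_⟩
    · have e : window M 0 k = window M (k - K) K * window M 0 (k - K) := by
        have := window_add M 0 (k - K) K
        rwa [Nat.sub_add_cancel hk, zero_add] at this
      rw [e, Matrix.mul_apply]
      calc η = ∑ c, η * window M 0 (k - K) c r := by
            rw [← mul_sum, sum_col_of_mem_colStochastic (window_mem _ hM 0 (k - K)), mul_one]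
        _ ≤ _ := sum_le_sum fun c _ => mul_le_mul_of_nonneg_right (hr _ _) (hge _ _ _ _)
    · have e : window M 0 k = window M l (k - l) * window M 0 l := by
        have := window_add M 0 l (k - l)
        rwa [Nat.add_sub_cancel' hl, zero_add] at this
      have e2 : window M l (k - l) r b - window M 0 k r r
          = ∑ c, (window M l (k - l) r b - window M l (k - l) r c) * window M 0 l c r := by
        rw [e, Matrix.mul_apply]
        simp only [sub_mul, sum_sub_distrib]
        rw [← mul_sum, sum_col_of_mem_colStochastic (window_mem _ hM 0 l), mul_one]
      have hosc : ∀ c, |window M l (k - l) r b - window M l (k - l) r c| ≤ C * ρ ^ (k - l) :=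
        fun c => abs_le.2 ⟨by linarith [window_row_sub_le hM hr l (k - l) r c b, hC (k - l)],
          (window_row_sub_le hM hr l (k - l) r b c).trans (hC _)⟩
      rw [e2]
      refine (abs_sum_le_sum_abs _ _).trans ?_
      calc _ ≤ ∑ c, C * ρ ^ (k - l) * window M 0 l c r := sum_le_sum fun c _ => by
            rw [abs_mul, abs_of_nonneg (hge 0 l c r)]
            exact mul_le_mul_of_nonneg_right (hosc c) (hge _ _ _ _)
        _ = _ := by
            rw [← mul_sum, sum_col_of_mem_colStochastic (window_mem _ hM 0 l), mul_one]

/-- In a driven column-stochastic system, node `r` tracks a share of the total mass. -/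
theorem exists_norm_sub_smul_le_of_colStochastic (hM : ∀ k, M k ∈ colStochastic ℝ Ω) {η : ℝ}
    (hη0 : 0 ≤ η) (hη1 : η ≤ 1) {K : ℕ} {r : Ω} (hr : ∀ l b, η ≤ window M l K r b)
    {C ρ : ℝ} (hC : ∀ j : ℕ, (1 - η) ^ (j / K) ≤ C * ρ ^ j)
    {y : ℕ → Ω → E} {p : ℕ → Ω} {δ : ℕ → E}
    (h : ∀ k a, y (k + 1) a = ∑ b, M k a b • (y k b + Pi.single (M := fun _ => E) (p k) (δ k) b))
    (k : ℕ) :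
    ∃ ξ : ℝ, η ≤ ξ ∧ ξ ≤ 1 ∧ ‖y k r - ξ • (∑ b, y 0 b + ∑ l ∈ range k, δ l)‖
      ≤ fading C ρ (∑ b, ‖y 0 b‖) (fun l => ‖δ l‖) k := by
  obtain ⟨ξ, h0, h1, hξ⟩ := exists_share hM hη0 hη1 hr hC k
  refine ⟨ξ, h0, h1, ?_⟩
  have e : y k r - ξ • (∑ b, y 0 b + ∑ l ∈ range k, δ l) = ∑ b, (window M 0 k r b - ξ) • y 0 b
      + ∑ l ∈ range k, (window M l (k - l) r (p l) - ξ) • δ l := by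
    rw [solution_eq h k r]
    simp only [sub_smul, sum_sub_distrib, smul_add, smul_sum]
    abel
  rw [e, fading]
  refine (norm_add_le _ _).trans (add_le_add ?_ ?_)
  · rw [mul_sum]
    refine norm_sum_le_of_le _ fun b _ => ?_
    rw [norm_smul, Real.norm_eq_abs]
    exact mul_le_mul_of_nonneg_right (hξ 0 (Nat.zero_le _) b) (norm_nonneg _)
  · refine norm_sum_le_of_le _ fun l hl => ?_
    rw [norm_smul, Real.norm_eq_abs]
    exact mul_le_mul_of_nonneg_right (hξ l (mem_range.1 hl).le _) (norm_nonneg _)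

/-- A weighted mean of the nodes of a driven averaging system that up to time `N` is moved by the
inputs only. Its weights are the influence of the nodes on an arbitrary node at time `N + K`; those
of the driven nodes are thus at least `η`. -/
theorem exists_mean_of_rowStochastic [Nonempty Ω] (hM : ∀ k, M k ∈ rowStochastic ℝ Ω) {η : ℝ}
    {K : ℕ} {y : ℕ → Ω → E} {p : ℕ → Ω} {δ : ℕ → E}
    (hr : ∀ l a k, η ≤ window M l K a (p k))
    (h : ∀ k a, y (k + 1) a = ∑ b, M k a b • (y k b + Pi.single (M := fun _ => E) (p k) (δ k) b))
    (N : ℕ) :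
    ∃ (q : ℕ → ℝ) (w : ℕ → E), (∀ k < N, w (k + 1) = w k + q k • δ k) ∧
      (∀ k < N, η ≤ q k ∧ q k ≤ 1) ∧
      (∀ k a c, (∀ b, ‖y k a - y k b‖ ≤ c) → ‖y k a - w k‖ ≤ c) ∧
      ‖w 0‖ ≤ ∑ b, ‖y 0 b‖ := by
  obtain ⟨a₀⟩ := ‹Nonempty Ω›
  have hw := fun k => window_mem _ hM k (N + K - k)
  refine ⟨fun k => window M k (N + K - k) a₀ (p k),
    fun k => ∑ b, window M k (N + K - k) a₀ b • y k b, fun k hk => ?_, fun k hk => ⟨?_, ?_⟩,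
    fun k a c hc => ?_, ?_⟩
  · have e : window M k (N + K - k) = window M (k + 1) (N + K - (k + 1)) * M k := by
      have := window_add M k 1 (N + K - (k + 1))
      rw [show 1 + (N + K - (k + 1)) = N + K - k by omega] at this
      simpa [window] using this
    have e2 : window M k (N + K - k) a₀ (p k) • δ k
        = ∑ b, window M k (N + K - k) a₀ b • Pi.single (M := fun _ => E) (p k) (δ k) b := by
      rw [Finset.sum_eq_single (p k)]
      · simp
      · intro b _ hb
        simp [hb]
      · simp
    beta_reduce
    rw [e2, ← sum_add_distrib]
    simp only [h, ← smul_add]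
    rw [e]
    simp only [Matrix.mul_apply, sum_smul, smul_sum, mul_smul]
    rw [sum_comm]
  · have e := window_add M k K (N - k)
    rw [show K + (N - k) = N + K - k by omega] at e
    beta_reduce
    rw [e, Matrix.mul_apply]
    calc η = ∑ c, window M (k + K) (N - k) a₀ c * η := by
          rw [← Finset.sum_mul, sum_row_of_mem_rowStochastic (window_mem _ hM (k + K) (N - k)),
            one_mul]
      _ ≤ _ := sum_le_sum fun c _ => mul_le_mul_of_nonneg_left (hr _ _ _)
          (nonneg_of_mem_rowStochastic (window_mem _ hM (k + K) (N - k)))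
  · exact le_one_of_mem_rowStochastic (hw k)
  · have e : y k a - ∑ b, window M k (N + K - k) a₀ b • y k b
        = ∑ b, window M k (N + K - k) a₀ b • (y k a - y k b) := by
      simp only [smul_sub, sum_sub_distrib]
      rw [← sum_smul, sum_row_of_mem_rowStochastic (hw k), one_smul]
    rw [e]
    calc _ ≤ ∑ b, window M k (N + K - k) a₀ b * c := norm_sum_le_of_le _ fun b _ => by
          rw [norm_smul, Real.norm_of_nonneg (nonneg_of_mem_rowStochastic (hw k))]
          exact mul_le_mul_of_nonneg_left (hc b) (nonneg_of_mem_rowStochastic (hw k))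
      _ = c := by rw [← Finset.sum_mul, sum_row_of_mem_rowStochastic (hw k), one_mul]
  · refine norm_sum_le_of_le _ fun b _ => ?_
    rw [norm_smul, Real.norm_of_nonneg (nonneg_of_mem_rowStochastic (hw 0))]
    exact mul_le_of_le_one_left (norm_nonneg _) (le_one_of_mem_rowStochastic (hw 0))

/-- The row-stochastic matrix whose row `b` is the distribution `π` if `b ∈ B`, and the point mass
at `dest b` otherwise. -/
def branching (B : Finset Ω) (π : Ω → ℝ) (dest : Ω → Ω) : Matrix Ω Ω ℝ :=
  fun b c => if b ∈ B then π c else if dest b = c then 1 else 0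

theorem branching_mem_rowStochastic {B : Finset Ω} {π : Ω → ℝ} {dest : Ω → Ω}
    (h0 : ∀ c, 0 ≤ π c) (h1 : ∑ c, π c = 1) : branching B π dest ∈ rowStochastic ℝ Ω := by
  refine mem_rowStochastic_iff_sum.2 ⟨fun b c => ?_, fun b => ?_⟩
  · unfold branching
    split_ifs
    exacts [h0 c, zero_le_one, le_rfl]
  · by_cases hb : b ∈ B <;> simp [branching, hb, h1]

theorem sum_branching_smul (B : Finset Ω) (π : Ω → ℝ) (dest : Ω → Ω) (y : Ω → E) (b : Ω) :
    ∑ c, branching B π dest b c • y c = if b ∈ B then ∑ c, π c • y c else y (dest b) := by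
  by_cases hb : b ∈ B <;> simp [branching, hb]

theorem sum_branching_transpose_smul (B : Finset Ω) (π : Ω → ℝ) (dest : Ω → Ω) (y : Ω → E)
    (c : Ω) :
    ∑ b, (branching B π dest)ᵀ c b • y b
      = π c • ∑ b ∈ B, y b + ∑ b, if b ∉ B ∧ dest b = c then y b else 0 := by
  have e : ∑ b ∈ B, y b = ∑ b, if b ∈ B then y b else 0 := by
    rw [← sum_filter]
    simp
  rw [e, smul_sum, ← sum_add_distrib]
  refine sum_congr rfl fun b _ => ?_
  by_cases hb : b ∈ B <;> by_cases hd : dest b = c <;> simp [branching, hb, hd]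

end Products

/-! ### Weights and time stamps -/

section Basics

variable {V : Type*} {G : Digraph V} {m : ℝ} {M : Matrix V V ℝ}

theorem Compliant.nonneg (h : Compliant G m M) (hm : 0 ≤ m) (i j : V) : 0 ≤ M i j := by
  by_cases hij : i = j
  · exact hij ▸ hm.trans (h.diag i)
  by_cases ha : G.Adj j i
  · exact hm.trans (h.edge i j ha)
  · exact (h.zero i j hij ha).ge

variable [Fintype V]

theorem Compliant.le_one (h : Compliant G m M) (hm : 0 ≤ m) (hM : RowStochastic M) (i : V) :
    m ≤ 1 :=
  (h.diag i).trans <| (single_le_sum (f := fun j => M i j) (fun j _ => h.nonneg hm i j)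
    (mem_univ i)).trans (hM i).le

theorem Compliant.le_one_of_colStochastic (h : Compliant G m M) (hm : 0 ≤ m)
    (hM : ColStochastic M) (i : V) : m ≤ 1 :=
  (h.diag i).trans <| (single_le_sum (f := fun j => M j i) (fun j _ => h.nonneg hm j i)
    (mem_univ i)).trans (hM i).le

variable {n T D : ℕ} {f : V → EuclideanSpace ℝ (Fin n) → ℝ} {W A : Matrix V V ℝ} {γ : ℕ → ℝ}
  {act : ℕ → V} {d : ℕ → V → ℕ} {x₀ : V → EuclideanSpace ℝ (Fin n)} {s : Variables V n}

theorem Generated.τ_pred_le (h : Generated G f W A D γ act d x₀ s) (k : ℕ) {i j : V}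
    (hij : G.Adj j i) : s.τ ((k : ℤ) - 1) i j ≤ k := by
  induction k with
  | zero =>
    have := h.τ_init i j hij
    simp only [Nat.cast_zero, zero_sub, this]
    omega
  | succ k ih =>
    rw [show ((k + 1 : ℕ) : ℤ) - 1 = k by push_cast; ring]
    by_cases hi : i = act k
    · subst hi
      rw [h.purge k j hij]
      push_cast
      omega
    · rw [h.τ_keep k i j hij hi]
      push_cast
      omega

theorem Generated.τ_act_le (h : Generated G f W A D γ act d x₀ s) (k : ℕ) {j : V}
    (hij : G.Adj j (act k)) : s.τ k (act k) j ≤ k := by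
  have := h.τ_pred_le k hij
  rw [h.purge k j hij]
  omega

/-- The effective delay `k - τ_{ij}^k` of the information that the active agent `i` reads from its
in-neighbour `j` at iteration `k`. It is at most `D`; the truncation only makes it a total function,
which may take any value when `j` is not an in-neighbour. -/
def lag (D : ℕ) (act : ℕ → V) (s : Variables V n) (k : ℕ) (j : V) : Fin (D + 1) :=
  ⟨min D ((k : ℤ) - s.τ k (act k) j).toNat, by omega⟩

theorem Generated.lag_eq (h : Generated G f W A D γ act d x₀ s) (hm : AsyncModel G T D act d)
    (k : ℕ) {j : V} (hij : G.Adj j (act k)) :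
    s.τ k (act k) j = (k : ℤ) - ((lag D act s k j : ℕ) : ℤ) := by
  have h1 := h.τ_act_le k hij
  have h2 := h.purge k j hij
  have h3 := hm.delay k j hij
  simp only [lag]
  omega

/-- A bound that holds along each directed edge with some loss holds uniformly for all nodes of a
strongly connected digraph. -/
theorem StronglyConnected.exists_uniform (hG : StronglyConnected G) (r : V) (c₀ c₁ : ℕ) :
    ∃ c : ℕ, ∀ P : V → ℕ → Prop, (∀ i a b, a ≤ b → P i a → P i b) → P r c₀ →
      (∀ i j a, G.Adj j i → P j a → P i (a + c₁)) → ∀ i, P i c := by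
  have h1 : ∀ i, ∃ c : ℕ, ∀ P : V → ℕ → Prop, P r c₀ →
      (∀ i j a, G.Adj j i → P j a → P i (a + c₁)) → P i c := by
    intro i
    induction hG r i with
    | refl => exact ⟨c₀, fun P h _ => h⟩
    | tail _ hbc ih =>
      obtain ⟨c, hc⟩ := ih
      exact ⟨c + c₁, fun P h h' => h' _ _ _ hbc (hc P h h')⟩
  choose c hc using h1
  exact ⟨univ.sup c, fun P hmono h h' i => hmono i _ _ (le_sup (mem_univ i)) (hc i P h h')⟩

end Basics

/-! ### The consensus system -/

section Consensus

variable {V : Type*} [Fintype V] {D : ℕ} {G : Digraph V} {m : ℝ} {W A : Matrix V V ℝ} {n T : ℕ}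
  {f : V → EuclideanSpace ℝ (Fin n) → ℝ} {γ : ℕ → ℝ} {act : ℕ → V} {d : ℕ → V → ℕ}
  {x₀ : V → EuclideanSpace ℝ (Fin n)} {s : Variables V n}

/-- The values carried by the nodes of the consensus system at iteration `k`. -/
def consensusState {n : ℕ} (D : ℕ) (s : Variables V n) (k : ℕ) :
    V × Option (Fin (D + 1)) → EuclideanSpace ℝ (Fin n)
  | (j, none) => s.x k j
  | (j, some a) => s.v ((k : ℤ) - (a : ℕ)) j

theorem Generated.sum_norm_consensusState_zero (h : Generated G f W A D γ act d x₀ s) :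
    ∑ b, ‖consensusState D s 0 b‖ = ∑ i, ‖x₀ i‖ := by
  rw [Fintype.sum_prod_type]
  refine sum_congr rfl fun j _ => ?_
  rw [Fintype.sum_option, Finset.sum_eq_zero, add_zero, consensusState, h.x_init]
  intro a _
  simp only [consensusState]
  rw [h.v_init, norm_zero]
  · have := a.2
    push_cast
    omega
  · push_cast
    omega

variable [DecidableEq V]

/-- The delayed consensus step as an averaging of nodes: `(j, none)` carries `x_j^k` and
`(j, some a)` carries `v_j^{k-a}`. The active agent `i` averages its own descent point with
the points `v_j^{k - e j}`, its new `v_i` is a copy of its descent point, and all other nodes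
are moved on in time. -/
def consensusMatrix (W : Matrix V V ℝ) (i : V) (e : V → Fin (D + 1)) :
    Matrix (V × Option (Fin (D + 1))) (V × Option (Fin (D + 1))) ℝ :=
  branching {(i, none)}
    (fun c => match c with
      | (j, none) => if j = i then W i i else 0
      | (j, some a) => if j ≠ i ∧ a = e j then W i j else 0)
    (fun b => match b with
      | (j, none) => (j, none)
      | (j, some a) => if a = 0 then if j = i then (j, none) else (j, some 0)
          else (j, some ⟨a.1 - 1, by omega⟩))

theorem sum_consensus_weights_smul {E : Type*} [AddCommGroup E] [Module ℝ E] (W : Matrix V V ℝ)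
    (i : V) (e : V → Fin (D + 1)) (y : V × Option (Fin (D + 1)) → E) :
    ∑ c, (match c with
      | (j, none) => if j = i then W i i else 0
      | (j, some a) => if j ≠ i ∧ a = e j then W i j else 0 : ℝ) • y c
    = W i i • y (i, none) + ∑ j ∈ univ.filter (· ≠ i), W i j • y (j, some (e j)) := by
  rw [Fintype.sum_prod_type]
  simp only [Fintype.sum_option, sum_add_distrib]
  congr 1
  · simp
  · rw [sum_filter]
    refine sum_congr rfl fun j _ => ?_
    by_cases hj : j = i <;> simp [hj]

theorem consensusMatrix_mem (hW : Compliant G m W) (hm : 0 ≤ m) (hWs : RowStochastic W)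
    (i : V) (e : V → Fin (D + 1)) : consensusMatrix W i e ∈ rowStochastic ℝ _ := by
  refine branching_mem_rowStochastic ?_ ?_
  · rintro ⟨j, _ | a⟩
    · dsimp only
      split_ifs
      exacts [hW.nonneg hm _ _, le_rfl]
    · dsimp only
      split_ifs
      exacts [hW.nonneg hm _ _, le_rfl]
  · have := sum_consensus_weights_smul W i e (fun _ => (1 : ℝ))
    simp only [smul_eq_mul, mul_one] at this
    rw [this, ← hWs i, ← Finset.add_sum_erase _ _ (mem_univ i)]
    congr 2
    ext j
    simp

/-- Within a number of iterations that depends only on the digraph and on the bounds `T`, `D`, the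
value of agent `r` has influenced all nodes of the consensus system. -/
theorem exists_reach_consensus (hG : StronglyConnected G) (hloop : ∀ i, ¬ G.Adj i i)
    (hm : 0 ≤ m) (T D : ℕ) (r : V) :
    ∃ c : ℕ, ∀ (W : Matrix V V ℝ) (act : ℕ → V) (e : ℕ → V → Fin (D + 1)),
      Compliant G m W → RowStochastic W → (∀ k i, ∃ t, k ≤ t ∧ t < k + T ∧ act t = i) →
      ∀ l t, l + c ≤ t → ∀ a,
        Reaches (fun k => consensusMatrix W (act k) (e k)) m l (r, none) t a := by
  obtain ⟨c, hc⟩ := hG.exists_uniform r 0 (2 * T + D)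
  refine ⟨c + T + D, fun W act e hW hWs hact l t ht a => ?_⟩
  set M := fun k => consensusMatrix W (act k) (e k) with hM
  have hM0 : ∀ k a b, 0 ≤ M k a b := fun k a b =>
    nonneg_of_mem_rowStochastic (consensusMatrix_mem hW hm hWs _ _)
  have hm1 : m ≤ 1 := hW.le_one hm hWs r
  -- A value held by `x_j` is kept, and passed on to `v_j` once `j` has been active.
  have hkeep : ∀ j t₀, l ≤ t₀ → Reaches M m l (r, none) t₀ (j, none) →
      ∀ t ≥ t₀, Reaches M m l (r, none) t (j, none) := by
    intro j t₀ hl h t ht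
    induction t, ht using Nat.le_induction with
    | base => exact h
    | succ t ht ih =>
      refine ih.step hM0 hm (hl.trans ht) ?_
      by_cases hj : j = act t
      · simp [hM, consensusMatrix, branching, hj, hW.diag]
      · simp [hM, consensusMatrix, branching, hj, hm1]
  have hv : ∀ j t₀, l ≤ t₀ → (∀ t ≥ t₀, Reaches M m l (r, none) t (j, none)) →
      ∀ a : Fin (D + 1), ∀ t ≥ t₀ + T + a, Reaches M m l (r, none) t (j, some a) := by
    intro j t₀ hl h
    have h0 : ∀ t ≥ t₀ + T, Reaches M m l (r, none) t (j, some 0) := by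
      obtain ⟨t₁, h1, h2, h3⟩ := hact t₀ j
      have : ∀ t ≥ t₁ + 1, Reaches M m l (r, none) t (j, some 0) := by
        intro t ht
        induction t, ht using Nat.le_induction with
        | base =>
          refine (h t₁ h1).step hM0 hm (hl.trans h1) ?_
          simp [hM, consensusMatrix, branching, h3, hm1]
        | succ t ht ih =>
          by_cases hj : j = act t
          · refine (h t (by omega)).step hM0 hm (by omega) ?_
            simp [hM, consensusMatrix, branching, hj, hm1]
          · refine ih.step hM0 hm (by omega) ?_
            simp [hM, consensusMatrix, branching, hj, hm1]
      exact fun t ht => this t (by omega)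
    rintro ⟨a, ha⟩
    induction a with
    | zero => exact h0
    | succ a ih =>
      intro t ht
      dsimp only at ht ih
      obtain ⟨t, rfl⟩ : ∃ t', t = t' + 1 := ⟨t - 1, by omega⟩
      refine (ih (by omega) t (by omega)).step hM0 hm (by omega) ?_
      simp [hM, consensusMatrix, branching, hm1]
  have hx : ∀ i, ∀ t ≥ l + c, Reaches M m l (r, none) t (i, none) := by
    refine hc (fun i b => ∀ t ≥ l + b, Reaches M m l (r, none) t (i, none)) ?_ ?_ ?_
    · exact fun i a b hab h t ht => h t (by omega)
    · exact hkeep r l le_rfl (Reaches.refl M m l _)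
    · intro i j b hji hj
      have hji' : j ≠ i := fun h => hloop i (h ▸ hji)
      obtain ⟨t₁, h1, h2, h3⟩ := hact (l + b + T + D) i
      have hr := hv j (l + b) (by omega) hj (e t₁ j) t₁ (by omega)
      have := hr.step hM0 hm (by omega) (c' := (i, none)) (by
        simp [hM, consensusMatrix, branching, h3, hji', hW.edge i j hji])
      exact fun t ht => hkeep i _ (by omega) this t (by omega)
  obtain ⟨j, _ | a⟩ := a
  · exact hx j t (by omega)
  · exact hv j (l + c) (by omega) (hx j) a t (by omega)

theorem Generated.consensusState_succ (h : Generated G f W A D γ act d x₀ s)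
    (hW : Compliant G m W) (hA : AsyncModel G T D act d) (hloop : ∀ i, ¬ G.Adj i i)
    (k : ℕ) (a : V × Option (Fin (D + 1))) :
    consensusState D s (k + 1) a = ∑ b, consensusMatrix W (act k) (lag D act s k) a b •
      (consensusState D s k b + Pi.single (M := fun _ => EuclideanSpace ℝ (Fin n))
        (act k, none) (-(γ k • s.z k (act k))) b) := by
  rw [consensusMatrix, sum_branching_smul, sum_consensus_weights_smul]
  have hdesc : s.x k (act k) + -(γ k • s.z k (act k)) = s.v ((k : ℤ) + 1) (act k) := by
    rw [h.descent k, sub_eq_add_neg]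
  obtain ⟨j, _ | a⟩ := a
  · by_cases hj : j = act k
    · subst hj
      rw [if_pos (by simp)]
      simp only [consensusState, Pi.single_eq_same, hdesc, h.consensus k]
      congr 1
      rw [inNbrs, sum_filter, sum_filter]
      refine sum_congr rfl fun j _ => ?_
      by_cases hadj : G.Adj j (act k)
      · have hne : j ≠ act k := fun e => hloop _ (e ▸ hadj)
        simp [hadj, hne, h.lag_eq hA k hadj]
      · by_cases hne : j = act k
        · simp [hne, hloop]
        · simp [hadj, hne, hW.zero _ _ (Ne.symm hne) hadj]
    · rw [if_neg (by simp [hj])]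
      simp [consensusState, hj, h.x_keep k j hj]
  · rw [if_neg (by simp)]
    by_cases ha : a = 0
    · subst ha
      by_cases hj : j = act k
      · subst hj
        simp only [if_true, consensusState, Pi.single_eq_same, hdesc]
        simp
      · simp [consensusState, hj, h.v_keep k j hj]
    · have ha' : 1 ≤ (a : ℕ) := by
        rw [Nat.one_le_iff_ne_zero]
        exact fun e => ha (Fin.ext e)
      have e : (k : ℤ) + 1 - (a : ℕ) = (k : ℤ) - ((a - 1 : ℕ) : ℤ) := by omega
      simp [consensusState, ha, e]

/-- The local copies agree up to a fading memory of the step lengths, and up to any horizon `N` they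
stay close to a point that moves along `-z` of the active agent, with a factor bounded below. -/
theorem exists_consensus_bound (G : Digraph V) (hloop : ∀ i, ¬ G.Adj i i)
    (hG : StronglyConnected G) {m : ℝ} (hm : 0 < m) (T D : ℕ) :
    ∃ C ρ η : ℝ, 0 < C ∧ 0 < ρ ∧ ρ < 1 ∧ 0 < η ∧ η ≤ 1 ∧
      ∀ {n : ℕ} {f : V → EuclideanSpace ℝ (Fin n) → ℝ} {W A : Matrix V V ℝ} {γ : ℝ}
        {act : ℕ → V} {d : ℕ → V → ℕ} {x₀ : V → EuclideanSpace ℝ (Fin n)} {s : Variables V n},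
        Compliant G m W → RowStochastic W → AsyncModel G T D act d → 0 ≤ γ →
        Generated G f W A D (fun _ => γ) act d x₀ s →
        let σ := fading C ρ (∑ i, ‖x₀ i‖) (fun l => γ * ‖s.z l (act l)‖)
        (∀ k i j, ‖s.x k i - s.x k j‖ ≤ σ k) ∧
        (∀ k, ‖s.x (k + 1) (act k) - s.x k (act k)‖ ≤ σ k + γ * ‖s.z k (act k)‖) ∧
        ∀ N, ∃ (q : ℕ → ℝ) (w : ℕ → EuclideanSpace ℝ (Fin n)),
          (∀ k < N, w (k + 1) = w k - (γ * q k) • s.z k (act k)) ∧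
          (∀ k < N, η ≤ q k ∧ q k ≤ 1) ∧
          (∀ k i, ‖s.x k i - w k‖ ≤ σ k) ∧ ‖w 0‖ ≤ ∑ i, ‖x₀ i‖ := by
  choose c hc using exists_reach_consensus (m := m) hG hloop hm.le T D
  set K := univ.sup c + 1 with hK
  have hη0 : 0 < min (m ^ K) (1 / 2) := by positivity
  obtain ⟨C, ρ, hC, hρ, hρ1, hCρ⟩ := exists_geometric_bound hη0
    (by linarith [min_le_right (m ^ K) (1 / 2)]) (Nat.succ_pos _ : 0 < K)
  refine ⟨C, ρ, min (m ^ K) (1 / 2), hC, hρ, hρ1, hη0,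
    by linarith [min_le_right (m ^ K) (1 / 2)], ?_⟩
  intro n f W A γ act d x₀ s hW hWs hA hγ h σ
  have hM := fun k => consensusMatrix_mem hW hm.le hWs (act k) (lag D act s k)
  have hr : ∀ r l a, min (m ^ K) (1 / 2) ≤
      window (fun k => consensusMatrix W (act k) (lag D act s k)) l K a (r, none) := by
    intro r l a
    have h1 := hc r W act (lag D act s) hW hWs hA.active l (l + K)
      (by have := le_sup (f := c) (mem_univ r); omega) a
    rw [Reaches, Nat.add_sub_cancel_left] at h1
    exact (min_le_left _ _).trans h1
  have hy := h.consensusState_succ hW hA hloop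
  have hσ : ∀ k a b, ‖consensusState D s k a - consensusState D s k b‖ ≤ σ k := by
    intro k a b
    have := norm_sub_le_of_rowStochastic hM (hr (act 0)) hCρ hy k a b
    simpa only [h.sum_norm_consensusState_zero, norm_neg, norm_smul, Real.norm_of_nonneg hγ]
      using this
  refine ⟨fun k i j => hσ k (i, none) (j, none), fun k => ?_, fun N => ?_⟩
  · have e := hy k (act k, none)
    have hrow := hM k
    set M := consensusMatrix W (act k) (lag D act s k)
    have e2 : s.x (k + 1) (act k) - s.x k (act k) = ∑ b, M (act k, none) b •
        (consensusState D s k b - consensusState D s k (act k, none)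
          + Pi.single (M := fun _ => EuclideanSpace ℝ (Fin n))
            (act k, none) (-(γ • s.z k (act k))) b) := by
      have e3 : s.x k (act k) = ∑ b, M (act k, none) b • consensusState D s k (act k, none) := by
        rw [← sum_smul, sum_row_of_mem_rowStochastic hrow, one_smul]
        rfl
      calc _ = consensusState D s (k + 1) (act k, none) - s.x k (act k) := rfl
        _ = _ := by
          rw [e, e3, ← sum_sub_distrib]
          refine sum_congr rfl fun b _ => ?_
          rw [← smul_sub]
          congr 1
          abel
    rw [e2]
    calc _ ≤ ∑ b, M (act k, none) b * (σ k + γ * ‖s.z k (act k)‖) := by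
          refine norm_sum_le_of_le _ fun b _ => ?_
          rw [norm_smul, Real.norm_of_nonneg (nonneg_of_mem_rowStochastic hrow)]
          refine mul_le_mul_of_nonneg_left ?_ (nonneg_of_mem_rowStochastic hrow)
          refine (norm_add_le _ _).trans (add_le_add (hσ _ _ _) ?_)
          by_cases hb : b = (act k, none)
          · subst hb
            rw [Pi.single_eq_same, norm_neg, norm_smul, Real.norm_of_nonneg hγ]
          · rw [Pi.single_eq_of_ne hb, norm_zero]
            positivity
      _ = _ := by rw [← Finset.sum_mul, sum_row_of_mem_rowStochastic hrow, one_mul]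
  · have : Nonempty (V × Option (Fin (D + 1))) := ⟨(act 0, none)⟩
    obtain ⟨q, w, h1, h2, h3, h4⟩ := exists_mean_of_rowStochastic hM
      (fun l a k => hr (act k) l a) hy N
    refine ⟨q, w, fun k hk => ?_, h2, fun k i => h3 k (i, none) _ (hσ k _), ?_⟩
    · rw [h1 k hk, smul_neg, smul_smul, mul_comm, ← sub_eq_add_neg]
    · rwa [h.sum_norm_consensusState_zero] at h4

end Consensus

/-! ### The gradient tracking system -/

section Tracking

variable {V : Type*} [Fintype V] {D : ℕ} {G : Digraph V} {m : ℝ} {W A : Matrix V V ℝ} {n T : ℕ}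
  {f : V → EuclideanSpace ℝ (Fin n) → ℝ} {γ : ℕ → ℝ} {act : ℕ → V} {d : ℕ → V → ℕ}
  {x₀ : V → EuclideanSpace ℝ (Fin n)} {s : Variables V n}

/-- The cumulative mass sent from `j` to `i` up to `a` iterations before `k`, not counting mass sent
after `i` last read, for `a ≤ D`; for `a > D`, the mass that `i` has read before iteration `k`. -/
def sentMass (D : ℕ) (s : Variables V n) (k : ℕ) (i j : V) (a : ℕ) : EuclideanSpace ℝ (Fin n) :=
  s.ρ (if a ≤ D then max ((k : ℤ) - a) (s.τ ((k : ℤ) - 1) i j) else s.τ ((k : ℤ) - 1) i j) i j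

open Classical in
/-- The mass held by the nodes of the tracking system at iteration `k`: agent `i` holds `z_i^k`, and
the node `(i, j, a)` holds the mass in transit from `j` to `i` that was sent `a` iterations ago, or
at least `D` iterations ago if `a = D`. -/
noncomputable def trackingState (G : Digraph V) (D : ℕ) (s : Variables V n) (k : ℕ) :
    V ⊕ (V × V × Fin (D + 1)) → EuclideanSpace ℝ (Fin n)
  | .inl i => s.z k i
  | .inr (i, j, a) => if G.Adj j i then sentMass D s k i j a - sentMass D s k i j (a + 1) else 0

theorem Generated.ρt_eq (h : Generated G f W A D γ act d x₀ s) (k : ℕ) {i j : V}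
    (hij : G.Adj j i) : s.ρt k i j = s.ρ (s.τ ((k : ℤ) - 1) i j) i j := by
  induction k with
  | zero =>
    rw [h.ρt_init i j hij, Nat.cast_zero, zero_sub, h.τ_init i j hij,
      h.ρ_init _ i j hij le_rfl (by omega)]
  | succ k ih =>
    rw [show ((k + 1 : ℕ) : ℤ) - 1 = k by push_cast; ring]
    by_cases hi : i = act k
    · subst hi
      exact h.buffer k j hij
    · rw [h.ρt_keep k i j hij hi, h.τ_keep k i j hij hi, ih]

theorem Generated.sentMass_sub_sentMass (h : Generated G f W A D γ act d x₀ s)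
    (hA : AsyncModel G T D act d) (k : ℕ) {j : V} (hij : G.Adj j (act k)) :
    sentMass D s k (act k) j (lag D act s k j) - sentMass D s k (act k) j (D + 1)
      = s.ρ (s.τ k (act k) j) (act k) j - s.ρt k (act k) j := by
  have h1 := h.lag_eq hA k hij
  have h2 := h.purge k j hij
  have h3 := (lag D act s k j).2
  rw [h.ρt_eq k hij, sentMass, sentMass, if_pos (by omega), if_neg (by omega), ← h1,
    max_eq_left (h2 ▸ le_max_left _ _)]

theorem Generated.sentMass_succ_of_ne (h : Generated G f W A D γ act d x₀ s) (k : ℕ) {i j : V}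
    (hij : G.Adj j i) (hi : i ≠ act k) {a : ℕ} (ha : a < D) :
    sentMass D s (k + 1) i j (a + 1) = sentMass D s k i j a := by
  rw [sentMass, sentMass, show ((k + 1 : ℕ) : ℤ) - 1 = k by push_cast; ring,
    h.τ_keep k i j hij hi, if_pos (by omega), if_pos (by omega)]
  congr 2
  push_cast
  ring

theorem Generated.sentMass_last_of_ne (h : Generated G f W A D γ act d x₀ s) (k : ℕ) {i j : V}
    (hij : G.Adj j i) (hi : i ≠ act k) :
    sentMass D s (k + 1) i j (D + 1) = sentMass D s k i j (D + 1) := by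
  rw [sentMass, sentMass, show ((k + 1 : ℕ) : ℤ) - 1 = k by push_cast; ring,
    h.τ_keep k i j hij hi, if_neg (by omega), if_neg (by omega)]

/-- Reading resets the reference level to the mass sent up to `lag` iterations ago. -/
theorem Generated.sentMass_succ_act (h : Generated G f W A D γ act d x₀ s)
    (hA : AsyncModel G T D act d) (k : ℕ) {j : V} (hij : G.Adj j (act k)) {a : ℕ} (ha : a ≤ D) :
    sentMass D s (k + 1) (act k) j (a + 1)
      = sentMass D s k (act k) j (min a (lag D act s k j)) := by
  have h1 := h.lag_eq hA k hij
  have h2 := h.purge k j hij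
  have h3 := (lag D act s k j).2
  rw [sentMass, sentMass, show ((k + 1 : ℕ) : ℤ) - 1 = k by push_cast; ring]
  congr 1
  push_cast
  split_ifs <;> omega

theorem Generated.sentMass_zero_sub (h : Generated G f W A D γ act d x₀ s) (hD : 0 < D) (k : ℕ)
    {i j : V} (hij : G.Adj j i) :
    sentMass D s (k + 1) i j 0 - sentMass D s (k + 1) i j 1
      = s.ρ ((k : ℤ) + 1) i j - s.ρ k i j := by
  have h1 := h.τ_pred_le (k + 1) hij
  have h2 : s.τ k i j ≤ k := by
    by_cases hi : i = act k
    · subst hi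
      exact h.τ_act_le k hij
    · rw [h.τ_keep k i j hij hi]
      exact h.τ_pred_le k hij
  rw [show ((k + 1 : ℕ) : ℤ) - 1 = k by push_cast; ring] at h1
  rw [sentMass, sentMass, show ((k + 1 : ℕ) : ℤ) - 1 = k by push_cast; ring, if_pos (by omega),
    if_pos (by omega)]
  push_cast at h1 ⊢
  congr 2 <;> omega

/-- The increment of the gradient of the agent active at iteration `k`. -/
noncomputable def gradInc (f : V → EuclideanSpace ℝ (Fin n) → ℝ) (act : ℕ → V)
    (s : Variables V n) (k : ℕ) : EuclideanSpace ℝ (Fin n) :=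
  gradient (f (act k)) (s.x (k + 1) (act k)) - gradient (f (act k)) (s.x k (act k))

theorem Generated.trackingState_zero_inr (h : Generated G f W A D γ act d x₀ s)
    (b : V × V × Fin (D + 1)) : trackingState G D s 0 (.inr b) = 0 := by
  obtain ⟨i, j, a⟩ := b
  simp only [trackingState]
  split_ifs with hij
  · have h1 := h.τ_init i j hij
    have : ∀ a, sentMass D s 0 i j a = 0 := by
      intro a
      rw [sentMass, Nat.cast_zero, zero_sub, zero_sub, h1]
      refine h.ρ_init _ i j hij ?_ ?_ <;> split_ifs <;> omega
    simp [this]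
  · rfl

theorem Generated.sum_gradient_eq (h : Generated G f W A D γ act d x₀ s) (k : ℕ) :
    ∑ i, gradient (f i) (s.x k i)
      = ∑ i, gradient (f i) (x₀ i) + ∑ l ∈ range k, gradInc f act s l := by
  induction k with
  | zero => simp [h.x_init]
  | succ k ih =>
    rw [sum_range_succ, ← add_assoc, ← ih, ← sub_eq_iff_eq_add', ← sum_sub_distrib,
      Finset.sum_eq_single (act k)]
    · rfl
    · intro i _ hi
      rw [h.x_keep k i hi, sub_self]
    · simp

variable {E : Type*} [AddCommGroup E]

theorem sum_ite_le_sub (g : ℕ → E) {e : ℕ} (he : e ≤ D) :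
    ∑ a : Fin (D + 1), (if e ≤ (a : ℕ) then g a - g (a + 1) else 0) = g e - g (D + 1) := by
  rw [Fin.sum_univ_eq_sum_range (fun a => if e ≤ a then g a - g (a + 1) else 0)]
  induction D, he using Nat.le_induction with
  | base =>
    rw [sum_range_succ, Finset.sum_eq_zero, zero_add, if_pos le_rfl]
    intro a ha
    rw [if_neg (by simpa using ha)]
  | succ N hN ih =>
    rw [sum_range_succ, ih, if_pos (by omega)]
    abel

theorem sum_ite_min_eq (g : ℕ → E) (P : ℕ → Prop) [DecidablePred P] {a : ℕ} (ha : a < D) :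
    ∑ b : Fin (D + 1), (if P b ∧ min ((b : ℕ) + 1) D = a + 1 then g b else 0)
      = (if P a then g a else 0) + if a + 1 = D ∧ P D then g D else 0 := by
  rw [Fin.sum_univ_eq_sum_range (fun b => if P b ∧ min (b + 1) D = a + 1 then g b else 0),
    sum_range_succ]
  congr 1
  · rw [Finset.sum_eq_single a]
    · rw [min_eq_left (by omega)]
      simp
    · intro b hb hne
      rw [if_neg]
      rw [mem_range] at hb
      omega
    · intro h
      exact absurd (mem_range.2 ha) h
  · rw [min_eq_right (by omega)]
    congr 1
    rw [and_comm, eq_comm (a := D)]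

variable [DecidableEq V]

/-- The nodes of the tracking system whose mass the active agent `i` collects: itself, and the mass
of age at least `e j` in transit from `j`. -/
def collected (i : V) (e : V → Fin (D + 1)) : Finset (V ⊕ (V × V × Fin (D + 1))) :=
  ({i} : Finset V).disjSum (univ.filter fun p => p.1 = i ∧ e p.2.1 ≤ p.2.2)

/-- The push-sum step as a redistribution of mass: of the collected mass, the active agent `i`
keeps the share `A i i` and sends the share `A j i` to `j`; all other mass in transit grows
older. -/
def trackingMatrix (A : Matrix V V ℝ) (i : V) (e : V → Fin (D + 1)) :
    Matrix (V ⊕ (V × V × Fin (D + 1))) (V ⊕ (V × V × Fin (D + 1))) ℝ :=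
  (branching (collected i e)
    (fun c => match c with
      | .inl j => if j = i then A i i else 0
      | .inr (j, l, a) => if l = i ∧ j ≠ i ∧ a = 0 then A j i else 0)
    (fun b => match b with
      | .inl j => .inl j
      | .inr (j, l, a) => .inr (j, l, ⟨min (a + 1) D, by omega⟩)))ᵀ

theorem trackingMatrix_mem (hA : Compliant G m A) (hm : 0 ≤ m) (hAs : ColStochastic A)
    (i : V) (e : V → Fin (D + 1)) : trackingMatrix A i e ∈ colStochastic ℝ _ := by
  refine transpose_mem_colStochastic_iff_mem_rowStochastic.2 (branching_mem_rowStochastic ?_ ?_)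
  · rintro (j | ⟨j, l, a⟩)
    · dsimp only
      split_ifs
      exacts [hA.nonneg hm _ _, le_rfl]
    · dsimp only
      split_ifs
      exacts [hA.nonneg hm _ _, le_rfl]
  · rw [Fintype.sum_sum_type]
    have h1 : ∀ j, ∑ p : V × Fin (D + 1), (if p.1 = i ∧ j ≠ i ∧ p.2 = 0 then A j i else 0)
        = if j ≠ i then A j i else 0 := by
      intro j
      rw [Finset.sum_eq_single (i, 0)]
      · simp
      · rintro ⟨l, a⟩ _ hne
        rw [if_neg]
        rintro ⟨rfl, -, rfl⟩
        exact hne rfl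
      · simp
    rw [Fintype.sum_prod_type]
    simp only [h1]
    rw [sum_ite_eq' univ i, if_pos (mem_univ i), ← hAs i, ← sum_filter,
      ← Finset.add_sum_erase _ _ (mem_univ i)]
    congr 2
    ext j
    simp

/-- Within a number of iterations that depends only on the digraph and on the bounds `T`, `D`, a
share of the mass at any node of the tracking system arrives at all agents. -/
theorem exists_reach_tracking (hG : StronglyConnected G) (hloop : ∀ i, ¬ G.Adj i i)
    (hm : 0 ≤ m) (T D : ℕ) :
    ∃ c : ℕ, ∀ (A : Matrix V V ℝ) (act : ℕ → V) (e : ℕ → V → Fin (D + 1)),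
      Compliant G m A → ColStochastic A → (∀ k i, ∃ t, k ≤ t ∧ t < k + T ∧ act t = i) →
      ∀ l t, l + c ≤ t → ∀ b i,
        Reaches (fun k => trackingMatrix A (act k) (e k)) m l b t (.inl i) := by
  choose c hc using fun r => hG.exists_uniform r (D + T) (2 * T + D)
  refine ⟨univ.sup c, fun A act e hA hAs hact l t ht b i => ?_⟩
  set M := fun k => trackingMatrix A (act k) (e k) with hM
  have hM0 : ∀ k a b, 0 ≤ M k a b := fun k a b =>
    nonneg_of_mem_colStochastic (trackingMatrix_mem hA hm hAs _ _)
  have hm1 : m ≤ 1 := hA.le_one_of_colStochastic hm hAs i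
  have hkeep : ∀ j t₀, l ≤ t₀ → Reaches M m l b t₀ (.inl j) →
      ∀ t ≥ t₀, Reaches M m l b t (.inl j) := by
    intro j t₀ hl h t ht
    induction t, ht using Nat.le_induction with
    | base => exact h
    | succ t ht ih =>
      refine ih.step hM0 hm (hl.trans ht) ?_
      by_cases hj : j = act t
      · simp [hM, trackingMatrix, branching, collected, hj, hA.diag]
      · simp [hM, trackingMatrix, branching, collected, hj, hm1]
  -- Mass in transit to `j` is collected once it has age `D` and `j` is active, if not before.
  have harrive : ∀ j p a t, l ≤ t → Reaches M m l b t (.inr (j, p, a)) →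
      ∀ t' ≥ t + D + T, Reaches M m l b t' (.inl j) := by
    intro j p a t hl h
    have hage : ∀ u, (∃ t' ≤ t + u, l ≤ t' ∧ Reaches M m l b t' (.inl j)) ∨
        ∃ a' : Fin (D + 1), min u D ≤ (a' : ℕ) ∧ Reaches M m l b (t + u) (.inr (j, p, a')) := by
      intro u
      induction u with
      | zero => exact .inr ⟨a, by omega, h⟩
      | succ u ih =>
        obtain ⟨t', h1, h2⟩ | ⟨a', h1, h2⟩ := ih
        · exact .inl ⟨t', by omega, h2⟩
        by_cases hB : j = act (t + u) ∧ e (t + u) p ≤ a'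
        · refine .inl ⟨t + u + 1, by omega, by omega, h2.step hM0 hm (by omega) ?_⟩
          simp [hM, trackingMatrix, branching, collected, ← hB.1, hA.diag, hB.2]
        · refine .inr ⟨⟨min (a' + 1) D, by omega⟩, by dsimp only; omega,
            h2.step hM0 hm (by omega) ?_⟩
          simp [hM, trackingMatrix, branching, collected, hB, hm1]
    obtain ⟨t₁, h1, h2, h3⟩ := hact (t + D) j
    obtain ⟨t', h4, h5, h6⟩ | ⟨a', h4, h5⟩ := hage (t₁ - t)
    · exact fun t'' ht'' => hkeep j t' h5 h6 t'' (by omega)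
    · rw [Nat.add_sub_cancel' (by omega)] at h5
      have h6 := h5.step hM0 hm (by omega) (c' := .inl j) (by
        have h7 : e t₁ p ≤ a' := Fin.le_def.2 (by have := (e t₁ p).2; omega)
        simp [hM, trackingMatrix, branching, collected, h3, h7, hA.diag])
      exact fun t'' ht'' => hkeep j _ (by omega) h6 t'' (by omega)
  have hstart : ∃ r, ∀ t ≥ l + (D + T), Reaches M m l b t (.inl r) := by
    obtain r | ⟨j, p, a⟩ := b
    · exact ⟨r, fun t ht => hkeep r l le_rfl (Reaches.refl M m l _) t (by omega)⟩
    · exact ⟨j, fun t ht => harrive j p a l le_rfl (Reaches.refl M m l _) t (by omega)⟩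
  obtain ⟨r, hr⟩ := hstart
  have := hc r (fun i c => ∀ t ≥ l + c, Reaches M m l b t (.inl i))
    (fun i a c hac h t ht => h t (by omega)) hr (by
      intro i j c hji hj t ht
      have hji' : i ≠ j := fun h => hloop i (h ▸ hji)
      obtain ⟨t₁, h1, h2, h3⟩ := hact (l + c) j
      have h4 := (hj t₁ h1).step hM0 hm (by omega) (c' := .inr (i, j, 0)) (by
        simp [hM, trackingMatrix, branching, collected, h3, hji', hA.edge i j hji])
      exact harrive i j 0 _ (by omega) h4 t (by omega)) i t
  exact this (by have := le_sup (f := c) (mem_univ r); omega)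

theorem Generated.sum_collected (h : Generated G f W A D γ act d x₀ s)
    (hA : AsyncModel G T D act d) (k : ℕ) :
    ∑ b ∈ collected (act k) (lag D act s k),
      (trackingState G D s k b + Pi.single (M := fun _ => EuclideanSpace ℝ (Fin n))
        (.inl (act k)) (gradInc f act s k) b) = s.zHalf k := by
  classical
  rw [collected, sum_disjSum, h.sumStep k, add_right_comm]
  congr 1
  · simp [trackingState, gradInc]
  · rw [sum_filter, Fintype.sum_prod_type, Finset.sum_eq_single (act k), Fintype.sum_prod_type,
      inNbrs, sum_filter]
    · refine sum_congr rfl fun j _ => ?_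
      by_cases hij : G.Adj j (act k)
      · have h1 := sum_ite_le_sub (D := D) (fun a => sentMass D s k (act k) j a)
          (Nat.lt_succ_iff.1 (lag D act s k j).2)
        rw [h.sentMass_sub_sentMass hA k hij] at h1
        simpa [trackingState, hij] using h1
      · simp [trackingState, hij]
    · intro j _ hj
      simp [hj]
    · simp

theorem Generated.trackingState_succ (h : Generated G f W A D γ act d x₀ s)
    (hAc : Compliant G m A) (hA : AsyncModel G T D act d) (hloop : ∀ i, ¬ G.Adj i i) (hD : 0 < D)
    (k : ℕ) (c : V ⊕ (V × V × Fin (D + 1))) :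
    trackingState G D s (k + 1) c = ∑ b, trackingMatrix A (act k) (lag D act s k) c b •
      (trackingState G D s k b + Pi.single (M := fun _ => EuclideanSpace ℝ (Fin n))
        (.inl (act k)) (gradInc f act s k) b) := by
  classical
  rw [trackingMatrix, sum_branching_transpose_smul, h.sum_collected hA k, Fintype.sum_sum_type]
  obtain i | ⟨i, j, a⟩ := c
  · by_cases hi : i = act k
    · subst hi
      rw [Finset.sum_eq_zero, Finset.sum_eq_zero]
      · simp [trackingState, h.push_z]
      · simp
      · intro j _
        rw [if_neg]
        rintro ⟨h1, h2⟩
        simp [collected] at h1 h2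
        exact h1 h2
    · rw [Finset.sum_eq_single i, Finset.sum_eq_zero (s := (univ : Finset (V × _)))]
      · simp [collected, trackingState, hi, h.z_keep k i hi]
      · simp
      · intro j _ hj
        simp [hj]
      · simp
  · rw [Finset.sum_eq_zero (s := (univ : Finset V)) (by simp), zero_add,
      Fintype.sum_prod_type, Finset.sum_eq_single i, Fintype.sum_prod_type,
      Finset.sum_eq_single j]
    rotate_left
    · intro j' _ hj'
      simp [hj']
    · simp
    · intro i' _ hi'
      simp [hi']
    · simp
    by_cases hij : G.Adj j i
    swap
    · have : (if j = act k ∧ i ≠ act k ∧ a = 0 then A i (act k) else 0) = 0 := by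
        split_ifs with hc
        · exact hAc.zero _ _ hc.2.1 (hc.1 ▸ hij)
        · rfl
      simp [trackingState, hij, this]
    obtain ⟨a, ha⟩ := a
    cases a with
    | zero =>
      rw [Finset.sum_eq_zero, add_zero]
      · simp only [trackingState, if_pos hij, zero_add]
        rw [h.sentMass_zero_sub hD k hij]
        by_cases hj : j = act k
        · subst hj
          have hne : i ≠ act k := fun e => hloop _ (e ▸ hij)
          simp [h.push_ρ k i hij, hne]
        · simp [h.ρ_keep k i j hij hj, hj]
      · intro b _
        rw [if_neg]
        simp only [Sum.inr.injEq, Prod.mk.injEq, Fin.mk.injEq]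
        omega
    | succ a =>
      have hs := sum_ite_min_eq (D := D)
        (fun b => sentMass D s k i j b - sentMass D s k i j (b + 1))
        (fun b => ¬ (i = act k ∧ ((lag D act s k j : Fin (D + 1)) : ℕ) ≤ b)) (a := a) (by omega)
      have hπ : ¬ (j = act k ∧ i ≠ act k ∧ (⟨a + 1, ha⟩ : Fin (D + 1)) = 0) := by
        simp [Fin.ext_iff]
      simp only [hπ, if_false, zero_smul, zero_add]
      refine Eq.trans ?_ (hs.symm.trans (sum_congr rfl fun b _ => ?_))
      · simp only [trackingState, if_pos hij]
        by_cases hi : i = act k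
        · subst hi
          rw [h.sentMass_succ_act hA k hij (by omega), h.sentMass_succ_act hA k hij (by omega)]
          have he := (lag D act s k j).2
          rw [if_neg (c := _ ∧ _) (by simp; omega), add_zero]
          by_cases hle : ((lag D act s k j : Fin (D + 1)) : ℕ) ≤ a
          · rw [if_neg (by simp [hle]), min_eq_right hle, min_eq_right (by omega), sub_self]
          · rw [if_pos (by simp [hle]), min_eq_left (by omega), min_eq_left (by omega)]
        · rw [h.sentMass_succ_of_ne k hij hi (by omega), if_pos (by simp [hi])]
          by_cases haD : a + 1 = D
          · rw [if_pos ⟨haD, by simp [hi]⟩, haD, h.sentMass_last_of_ne k hij hi]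
            abel
          · rw [if_neg (by simp [haD]), h.sentMass_succ_of_ne k hij hi (by omega), add_zero]
      · refine if_congr ?_ ?_ rfl
        · simp [collected, Fin.ext_iff]
        · simp [trackingState, hij]

/-- The tracking variable of the active agent is a share, bounded below, of the sum of the local
gradients, up to a fading memory of the gradient increments. -/
theorem exists_tracking_bound (G : Digraph V) (hloop : ∀ i, ¬ G.Adj i i)
    (hG : StronglyConnected G) {m : ℝ} (hm : 0 < m) (T D : ℕ) (hD : 0 < D) :
    ∃ C ρ η : ℝ, 0 < C ∧ 0 < ρ ∧ ρ < 1 ∧ 0 < η ∧ η ≤ 1 ∧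
      ∀ {n : ℕ} {f : V → EuclideanSpace ℝ (Fin n) → ℝ} {W A : Matrix V V ℝ} {γ : ℕ → ℝ}
        {act : ℕ → V} {d : ℕ → V → ℕ} {x₀ : V → EuclideanSpace ℝ (Fin n)} {s : Variables V n},
        Compliant G m A → ColStochastic A → AsyncModel G T D act d →
        Generated G f W A D γ act d x₀ s → ∀ k, ∃ ξ : ℝ, η ≤ ξ ∧ ξ ≤ 1 ∧
          ‖s.z k (act k) - ξ • ∑ i, gradient (f i) (s.x k i)‖
            ≤ fading C ρ (∑ i, ‖gradient (f i) (x₀ i)‖) (fun l => ‖gradInc f act s l‖) k := by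
  obtain ⟨c, hc⟩ := exists_reach_tracking (m := m) hG hloop hm.le T D
  set K := c + 1 with hK
  have hη0 : 0 < min (m ^ K) (1 / 2) := by positivity
  have hη1 : min (m ^ K) (1 / 2) < 1 := by linarith [min_le_right (m ^ K) (1 / 2)]
  obtain ⟨C, ρ, hC, hρ, hρ1, hCρ⟩ := exists_geometric_bound hη0 hη1 (Nat.succ_pos _ : 0 < K)
  refine ⟨C, ρ, min (m ^ K) (1 / 2), hC, hρ, hρ1, hη0, hη1.le, ?_⟩
  intro n f W A γ act d x₀ s hAc hAs hA h k
  have hr : ∀ l b, min (m ^ K) (1 / 2) ≤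
      window (fun k => trackingMatrix A (act k) (lag D act s k)) l K (.inl (act k)) b := by
    intro l b
    have h1 := hc A act (lag D act s) hAc hAs hA.active l (l + K) (by omega) b (act k)
    rw [Reaches, Nat.add_sub_cancel_left] at h1
    exact (min_le_left _ _).trans h1
  have := exists_norm_sub_smul_le_of_colStochastic
    (fun k => trackingMatrix_mem hAc hm.le hAs (act k) (lag D act s k)) hη0.le hη1.le hr hCρ
    (h.trackingState_succ hAc hA hloop hD) k
  have hz : ∀ i, trackingState G D s 0 (.inl i) = gradient (f i) (x₀ i) := h.z_init
  have hk : trackingState G D s k (.inl (act k)) = s.z k (act k) := rfl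
  simpa only [Fintype.sum_sum_type, h.trackingState_zero_inr, hz, hk, norm_zero, sum_const_zero,
    add_zero, h.sum_gradient_eq] using this

end Tracking

open scoped InnerProductSpace

/-! ### Descent and summation -/

section Descent

variable {E : Type*} [NormedAddCommGroup E] [InnerProductSpace ℝ E]

/-- The quadratic upper bound for a function with Lipschitz gradient. -/
theorem le_quadratic_of_lipschitz_gradient [CompleteSpace E] {F : E → ℝ}
    (hF : Differentiable ℝ F) {Λ : ℝ}
    (hL : ∀ x y, ‖gradient F x - gradient F y‖ ≤ Λ * ‖x - y‖) (x v : E) :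
    F (x + v) ≤ F x + ⟪gradient F x, v⟫_ℝ + Λ / 2 * ‖v‖ ^ 2 := by
  have hd : ∀ t : ℝ, HasDerivAt
      (fun t : ℝ => F (x + t • v) - t * ⟪gradient F x, v⟫_ℝ - Λ / 2 * ‖v‖ ^ 2 * t ^ 2)
      (⟪gradient F (x + t • v), v⟫_ℝ - ⟪gradient F x, v⟫_ℝ - Λ / 2 * ‖v‖ ^ 2 * (2 * t)) t := by
    intro t
    have h1 : HasDerivAt (fun t : ℝ => x + t • v) v t := by
      simpa using ((hasDerivAt_id t).smul_const v).const_add x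
    have h2 := (hF (x + t • v)).hasGradientAt.hasFDerivAt.comp_hasDerivAt t h1
    have h3 := (hasDerivAt_id t).mul_const ⟪gradient F x, v⟫_ℝ
    have h4 := ((hasDerivAt_id t).pow 2).const_mul (Λ / 2 * ‖v‖ ^ 2)
    exact ((h2.sub h3).sub h4).congr_deriv (by simp)
  have hanti : AntitoneOn
      (fun t : ℝ => F (x + t • v) - t * ⟪gradient F x, v⟫_ℝ - Λ / 2 * ‖v‖ ^ 2 * t ^ 2)
      (Set.Icc 0 1) := by
    refine antitoneOn_of_deriv_nonpos (convex_Icc 0 1)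
      (fun t _ => (hd t).continuousAt.continuousWithinAt)
      (fun t _ => (hd t).differentiableAt.differentiableWithinAt) fun t ht => ?_
    rw [interior_Icc] at ht
    rw [(hd t).deriv, ← inner_sub_left]
    have h1 := real_inner_le_norm (gradient F (x + t • v) - gradient F x) v
    have h2 := hL (x + t • v) x
    rw [add_sub_cancel_left, norm_smul, Real.norm_of_nonneg ht.1.le] at h2
    nlinarith [mul_le_mul_of_nonneg_right h2 (norm_nonneg v)]
  have := hanti (Set.left_mem_Icc.2 zero_le_one) (Set.right_mem_Icc.2 zero_le_one) zero_le_one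
  simp only [one_smul, zero_smul, add_zero] at this
  linarith

/-- A direction `z` close to a positive multiple of a vector close to `p` makes an acute angle
with `p`, up to the errors. -/
theorem inner_ge_of_approx {p g z : E} {ξ σ t : ℝ} (hξ0 : 0 ≤ ξ) (hξ1 : ξ ≤ 1)
    (hp : ‖p - g‖ ≤ σ) (hz : ‖z - ξ • g‖ ≤ t) :
    ‖z‖ ^ 2 / 2 - (σ ^ 2 + t ^ 2) ≤ ξ * ⟪p, z⟫_ℝ := by
  have hn : ‖ξ • p - z‖ ≤ σ + t := by
    have e : ξ • p - z = ξ • (p - g) - (z - ξ • g) := by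
      rw [smul_sub]
      abel
    rw [e]
    refine (norm_sub_le _ _).trans (add_le_add ?_ hz)
    rw [norm_smul, Real.norm_of_nonneg hξ0]
    exact (mul_le_of_le_one_left (norm_nonneg _) hξ1).trans hp
  have e : ξ * ⟪p, z⟫_ℝ = ⟪ξ • p - z, z⟫_ℝ + ‖z‖ ^ 2 := by
    rw [inner_sub_left, real_inner_smul_left, real_inner_self_eq_norm_sq]
    ring
  have h1 := (abs_le.1 (abs_real_inner_le_norm (ξ • p - z) z)).1
  have h2 := mul_le_mul_of_nonneg_right hn (norm_nonneg z)
  rw [e]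
  nlinarith [sq_nonneg (‖z‖ - (σ + t)), sq_nonneg (σ - t)]

/-- A step against a direction `z` that approximates a share of the gradient decreases a function
with the quadratic upper bound, up to the errors. -/
theorem descent_step {F : E → ℝ} {p w z g : E} {Λ γ q η₁ η₂ ξ σ t : ℝ}
    (hquad : ∀ v, F (w + v) ≤ F w + ⟪p, v⟫_ℝ + Λ / 2 * ‖v‖ ^ 2) (hΛ : 0 ≤ Λ) (hγ : 0 ≤ γ)
    (hη₁ : 0 < η₁) (hη₂ : 0 < η₂) (hq0 : η₁ ≤ q) (hq1 : q ≤ 1) (hξ0 : η₂ ≤ ξ) (hξ1 : ξ ≤ 1)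
    (hp : ‖p - g‖ ≤ σ) (hz : ‖z - ξ • g‖ ≤ t) :
    F (w - (γ * q) • z) ≤ F w - γ * η₁ / 2 * ‖z‖ ^ 2 + γ / η₂ * (σ ^ 2 + t ^ 2)
      + Λ / 2 * γ ^ 2 * ‖z‖ ^ 2 := by
  have hξpos : 0 < ξ := hη₂.trans_le hξ0
  have hqpos : 0 < q := hη₁.trans_le hq0
  have h1 := hquad (-((γ * q) • z))
  rw [← sub_eq_add_neg, inner_neg_right, real_inner_smul_right, norm_neg, norm_smul,
    mul_pow, Real.norm_eq_abs, sq_abs] at h1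
  have h2 := inner_ge_of_approx hξpos.le hξ1 hp hz
  have h3 : γ * (q / ξ) * (‖z‖ ^ 2 / 2 - (σ ^ 2 + t ^ 2)) ≤ γ * q * ⟪p, z⟫_ℝ := by
    have e : γ * q * ⟪p, z⟫_ℝ = γ * (q / ξ) * (ξ * ⟪p, z⟫_ℝ) := by field_simp
    rw [e]
    exact mul_le_mul_of_nonneg_left h2 (by positivity)
  have h4 : η₁ ≤ q / ξ := by
    rw [le_div_iff₀ hξpos]
    exact (mul_le_of_le_one_right hη₁.le hξ1).trans hq0
  have h5 : q / ξ ≤ 1 / η₂ := div_le_div₀ zero_le_one hq1 hη₂ hξ0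
  have h6 := mul_le_mul_of_nonneg_left h4 (show 0 ≤ γ * (‖z‖ ^ 2 / 2) by positivity)
  have h7 := mul_le_mul_of_nonneg_left h5 (show 0 ≤ γ * (σ ^ 2 + t ^ 2) by positivity)
  have h8 : Λ / 2 * ((γ * q) ^ 2 * ‖z‖ ^ 2) ≤ Λ / 2 * γ ^ 2 * ‖z‖ ^ 2 := by
    have h9 := mul_le_mul_of_nonneg_left (pow_le_one₀ (n := 2) hqpos.le hq1)
      (show 0 ≤ Λ / 2 * γ ^ 2 * ‖z‖ ^ 2 by positivity)
    linarith
  have e7 : γ * (σ ^ 2 + t ^ 2) * (1 / η₂) = γ / η₂ * (σ ^ 2 + t ^ 2) := by ring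
  linarith

theorem fading_succ (C ρ S : ℝ) (β : ℕ → ℝ) (k : ℕ) :
    fading C ρ S β (k + 1) = ρ * (fading C ρ S β k + C * β k) := by
  unfold fading
  rw [sum_range_succ, Nat.add_sub_cancel_left]
  have : ∑ l ∈ range k, C * ρ ^ (k + 1 - l) * β l
      = ρ * ∑ l ∈ range k, C * ρ ^ (k - l) * β l := by
    rw [mul_sum]
    refine sum_congr rfl fun l hl => ?_
    rw [Nat.succ_sub (mem_range.1 hl).le, pow_succ]
    ring
  rw [this]
  ring

/-- Fading memories of square-summable inputs are square-summable. -/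
theorem sum_fading_sq_le {C ρ : ℝ} (h0 : 0 < ρ) (h1 : ρ < 1) (S : ℝ) (β : ℕ → ℝ)
    (N : ℕ) :
    ∑ k ∈ range N, fading C ρ S β k ^ 2
      ≤ C ^ 2 / (1 - ρ) ^ 2 * (S ^ 2 + ∑ k ∈ range N, β k ^ 2) := by
  have hρ : 0 < 1 - ρ := by linarith
  have key : (1 - ρ) * fading C ρ S β N ^ 2 + (1 - ρ) ^ 2 * ∑ k ∈ range N, fading C ρ S β k ^ 2
      ≤ C ^ 2 * (S ^ 2 + ∑ k ∈ range N, β k ^ 2) := by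
    induction N with
    | zero =>
      simp only [fading, range_zero, sum_empty, pow_zero, mul_one, add_zero, mul_zero]
      nlinarith [sq_nonneg (C * S)]
    | succ N ih =>
      rw [sum_range_succ, sum_range_succ, fading_succ]
      set r := fading C ρ S β N
      -- Convexity of the square: `(ρ r + (1 - ρ) u)² ≤ ρ r² + (1 - ρ) u²` with `(1 - ρ) u = ρ C β`.
      have hc : (1 - ρ) * (ρ * (r + C * β N)) ^ 2 ≤ (1 - ρ) * ρ * r ^ 2 + C ^ 2 * β N ^ 2 := by
        have h2 : 0 ≤ ρ * ((1 - ρ) * r - ρ * (C * β N)) ^ 2 := by positivity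
        have h3 : 0 ≤ (1 - ρ) * (1 + ρ) * (C * β N) ^ 2 := by positivity
        nlinarith
      nlinarith
  rw [div_mul_eq_mul_div, le_div_iff₀ (by positivity)]
  nlinarith [mul_nonneg hρ.le (sq_nonneg (fading C ρ S β N))]

end Descent

section Total

variable {V : Type*} [Fintype V] {n : ℕ} {f : V → EuclideanSpace ℝ (Fin n) → ℝ} {L : V → NNReal}

theorem gradient_total (hf : ∀ i, Differentiable ℝ (f i)) (y : EuclideanSpace ℝ (Fin n)) :
    gradient (total f) y = ∑ i, gradient (f i) y := by
  refine HasGradientAt.gradient (hasGradientAt_iff_hasFDerivAt.2 ?_)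
  rw [map_sum]
  exact HasFDerivAt.fun_sum fun i _ => (hf i y).hasGradientAt.hasFDerivAt

theorem norm_gradient_total_sub_le (hf : ∀ i, Differentiable ℝ (f i))
    (hL : ∀ i, LipschitzWith (L i) (gradient (f i))) {x : V → EuclideanSpace ℝ (Fin n)}
    {y : EuclideanSpace ℝ (Fin n)} {c : ℝ} (hc : ∀ i, ‖x i - y‖ ≤ c) :
    ‖gradient (total f) y - ∑ i, gradient (f i) (x i)‖ ≤ (∑ i, (L i : ℝ)) * c := by
  rw [gradient_total hf, ← sum_sub_distrib, sum_mul]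
  refine norm_sum_le_of_le _ fun i _ => ?_
  rw [norm_sub_rev]
  exact ((hL i).norm_sub_le _ _).trans (mul_le_mul_of_nonneg_left (hc i) (L i).2)

theorem norm_sub_average_le {x : V → EuclideanSpace ℝ (Fin n)} {c : ℝ}
    (hc : ∀ i j, ‖x i - x j‖ ≤ c) (i : V) : ‖x i - average x‖ ≤ c := by
  have hV : (0 : ℝ) < Fintype.card V := by exact_mod_cast Fintype.card_pos_iff.2 ⟨i⟩
  have e : x i - average x = (1 / (Fintype.card V : ℝ)) • ∑ j, (x i - x j) := by
    rw [sum_sub_distrib, smul_sub, average, sum_const, card_univ, ← Nat.cast_smul_eq_nsmul ℝ,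
      smul_smul, one_div_mul_cancel hV.ne', one_smul]
  rw [e, norm_smul, Real.norm_of_nonneg (by positivity), one_div_mul_eq_div, div_le_iff₀ hV]
  refine (norm_sum_le_of_le _ fun j _ => hc i j).trans ?_
  rw [sum_const, card_univ, nsmul_eq_mul, mul_comm]

theorem merit_le (hf : ∀ i, Differentiable ℝ (f i))
    (hL : ∀ i, LipschitzWith (L i) (gradient (f i))) {x : V → EuclideanSpace ℝ (Fin n)}
    {z : EuclideanSpace ℝ (Fin n)} {η ξ σ t : ℝ} (hη : 0 < η) (hξ : η ≤ ξ)
    (hx : ∀ i j, ‖x i - x j‖ ≤ σ) (hz : ‖z - ξ • ∑ i, gradient (f i) (x i)‖ ≤ t) :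
    merit f x ≤ (3 * (∑ i, (L i : ℝ)) ^ 2 + Fintype.card V) * σ ^ 2
      + 3 / η ^ 2 * (‖z‖ ^ 2 + t ^ 2) := by
  have hav := norm_sub_average_le hx
  have h1 : ∑ i, ‖x i - average x‖ ^ 2 ≤ Fintype.card V * σ ^ 2 := by
    refine (sum_le_sum fun i _ => pow_le_pow_left₀ (norm_nonneg _) (hav i) 2).trans ?_
    rw [sum_const, card_univ, nsmul_eq_mul]
  have h2 := norm_gradient_total_sub_le hf hL hav
  set Λ := ∑ i, (L i : ℝ)
  set g := ∑ i, gradient (f i) (x i)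
  have h3 : ‖g‖ ≤ ‖z‖ / η + t / η := by
    rw [← add_div, le_div_iff₀ hη]
    calc _ ≤ ‖g‖ * ξ := mul_le_mul_of_nonneg_left hξ (norm_nonneg _)
      _ = ‖ξ • g‖ := by rw [norm_smul, Real.norm_of_nonneg (hη.le.trans hξ), mul_comm]
      _ ≤ _ := by
          have := norm_sub_norm_le (ξ • g) z
          rw [norm_sub_rev] at this
          linarith
  have h4 : ‖gradient (total f) (average x)‖ ≤ Λ * σ + (‖z‖ / η + t / η) := by
    have := norm_sub_norm_le (gradient (total f) (average x)) g
    linarith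
  have h5 : ‖gradient (total f) (average x)‖ ^ 2
      ≤ 3 * Λ ^ 2 * σ ^ 2 + 3 / η ^ 2 * (‖z‖ ^ 2 + t ^ 2) := by
    refine (pow_le_pow_left₀ (norm_nonneg _) h4 2).trans ?_
    have e : 3 * Λ ^ 2 * σ ^ 2 + 3 / η ^ 2 * (‖z‖ ^ 2 + t ^ 2)
        = 3 * (Λ * σ) ^ 2 + 3 * (‖z‖ / η) ^ 2 + 3 * (t / η) ^ 2 := by
      field_simp
      ring
    rw [e]
    generalize Λ * σ = u₁, ‖z‖ / η = u₂, t / η = u₃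
    linarith [sq_nonneg (u₁ - u₂), sq_nonneg (u₁ - u₃), sq_nonneg (u₂ - u₃)]
  have h6 : 0 ≤ (Fintype.card V : ℝ) * σ ^ 2 := by positivity
  have h7 : 0 ≤ 3 * Λ ^ 2 * σ ^ 2 + 3 / η ^ 2 * (‖z‖ ^ 2 + t ^ 2) := by positivity
  exact max_le (by linarith) (by linarith)

end Total

/-- If the partial sums of `μ` are at most `C`, then the first time with `μ ≤ δ` exists and is at
most `C / δ`: before it each term exceeds `δ`. -/
theorem exists_isLeast_le_div {μ : ℕ → ℝ} {C : ℝ} (hC : ∀ N, ∑ k ∈ range N, μ k ≤ C)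
    {δ : ℝ} (hδ : 0 < δ) : ∃ N : ℕ, IsLeast {k | μ k ≤ δ} N ∧ (N : ℝ) ≤ C / δ := by
  classical
  have hbound : ∀ N : ℕ, (∀ k < N, δ < μ k) → (N : ℝ) ≤ C / δ := by
    intro N hN
    rw [le_div_iff₀ hδ]
    refine le_trans ?_ (hC N)
    have := card_nsmul_le_sum (range N) μ δ fun k hk => (hN k (mem_range.1 hk)).le
    simpa using this
  have hne : ∃ k, μ k ≤ δ := by
    by_contra! hcon
    obtain ⟨N, hN⟩ := exists_nat_gt (C / δ)
    exact absurd (hbound N fun k _ => hcon k) (not_le.2 hN)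
  refine ⟨Nat.find hne, ⟨Nat.find_spec hne, fun k hk => Nat.find_min' hne hk⟩,
    hbound _ fun k hk => not_le.1 (Nat.find_min hne hk)⟩

/-- The small-gain step: the squared errors feed on the squared steps with gain `κ γ²`, and the
descent pays for them when `γ` is small. -/
theorem energy_bound {η₁ η₂ Λ γ κ P SA Sσ St B c₁ c₂ S₀ B₀ Sε : ℝ} (h1 : 0 < η₁)
    (h2 : 0 < η₂) (hγ : 0 < γ) (hγ1 : γ ≤ 1)
    (hc₁ : 0 ≤ c₁) (hc₂ : 0 ≤ c₂)
    (hSA : 0 ≤ SA)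
    (hκ : κ = Λ ^ 2 * c₁ + 2 * c₂ * Λ ^ 2 * (c₁ + 1))
    (hP : P = (Λ ^ 2 * c₁ + 2 * c₂ * Λ ^ 2 * c₁) * S₀ ^ 2 + c₂ * B₀ ^ 2)
    (hγκ : (κ / η₂ + Λ / 2) * γ ≤ η₁ / 4)
    (hσ : Sσ ≤ c₁ * (S₀ ^ 2 + γ ^ 2 * SA)) (hε : Sε ≤ 2 * Λ ^ 2 * (Sσ + γ ^ 2 * SA))
    (ht : St ≤ c₂ * (B₀ ^ 2 + Sε))
    (hdesc : 0 ≤ B - γ * η₁ / 2 * SA + γ / η₂ * (Λ ^ 2 * Sσ + St) + Λ / 2 * γ ^ 2 * SA) :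
    SA ≤ 4 * (B + γ * P / η₂) / (γ * η₁) ∧ Λ ^ 2 * Sσ + St ≤ P + κ * γ ^ 2 * SA := by
  have hQ : Λ ^ 2 * Sσ + St ≤ P + κ * γ ^ 2 * SA := by
    have a1 := mul_le_mul_of_nonneg_left hσ (sq_nonneg Λ)
    have a2 := mul_le_mul_of_nonneg_left hε hc₂
    have a3 := mul_le_mul_of_nonneg_left hσ (mul_nonneg hc₂ (sq_nonneg Λ))
    rw [hκ, hP]
    linarith
  refine ⟨?_, hQ⟩
  have hκ0 : 0 ≤ κ := by rw [hκ]; positivity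
  rw [le_div_iff₀ (by positivity)]
  have a1 := mul_le_mul_of_nonneg_left hQ (div_pos hγ h2).le
  have a2 : γ / η₂ * (κ * γ ^ 2 * SA) ≤ κ / η₂ * γ * (γ * SA) := by
    have : γ / η₂ * (κ * γ ^ 2 * SA) = κ / η₂ * γ * (γ * SA) * γ := by ring
    rw [this]
    exact mul_le_of_le_one_right (by positivity) hγ1
  have a3 := mul_le_mul_of_nonneg_right hγκ (mul_nonneg hγ.le hSA)
  have a4 : γ / η₂ * P = γ * P / η₂ := by ring
  linarith

end AsySonata

open Finset in
theorem theorem3 {V : Type*} [Fintype V]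
    -- the communication digraph, without self-loops and strongly connected
    (G : Digraph V) (hloop : ∀ i, ¬ G.Adj i i) (hconn : AsySonata.StronglyConnected G)
    -- the lower bound on the weights, the Lipschitz constants, and the asynchrony bounds
    (m : ℝ) (hm : 0 < m) (L : V → NNReal) (T D : ℕ) (hT : 0 < T) (hD : 0 < D) :
    ∃ γbar : ℝ, 0 < γbar ∧
      ∀ (n : ℕ) (f : V → EuclideanSpace ℝ (Fin n) → ℝ),
        (∀ i, Differentiable ℝ (f i)) →
        (∀ i, LipschitzWith (L i) (gradient (f i))) →
        BddBelow (Set.range (AsySonata.total f)) →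
        ∀ (x₀ : V → EuclideanSpace ℝ (Fin n)) (γ : ℝ), 0 < γ → γ ≤ γbar →
          ∃ C : ℝ, ∀ (W A : Matrix V V ℝ) (act : ℕ → V) (d : ℕ → V → ℕ)
            (s : AsySonata.Variables V n),
            AsySonata.Compliant G m W → AsySonata.RowStochastic W →
            AsySonata.Compliant G m A → AsySonata.ColStochastic A →
            AsySonata.AsyncModel G T D act d →
            AsySonata.Generated G f W A D (fun _ => γ) act d x₀ s →
            ∀ δ : ℝ, 0 < δ →
              ∃ Tδ : ℕ, IsLeast {k : ℕ | AsySonata.merit f (s.x k) ≤ δ} Tδ ∧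
                (Tδ : ℝ) ≤ C / δ := by
  classical
  obtain ⟨C₁, ρ₁, η₁, hC₁, hρ₁, hρ₁', hη₁, hη₁', hcons⟩ :=
    AsySonata.exists_consensus_bound G hloop hconn hm T D
  obtain ⟨C₂, ρ₂, η₂, hC₂, hρ₂, hρ₂', hη₂, hη₂', htrack⟩ :=
    AsySonata.exists_tracking_bound G hloop hconn hm T D hD
  set Λ : ℝ := ∑ i, (L i : ℝ) with hΛdef
  have hΛ : 0 ≤ Λ := sum_nonneg fun i _ => (L i).2
  obtain ⟨c₁, hc₁⟩ : ∃ c, c = C₁ ^ 2 / (1 - ρ₁) ^ 2 := ⟨_, rfl⟩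
  obtain ⟨c₂, hc₂⟩ : ∃ c, c = C₂ ^ 2 / (1 - ρ₂) ^ 2 := ⟨_, rfl⟩
  have hc₁0 : 0 ≤ c₁ := by rw [hc₁]; positivity
  have hc₂0 : 0 ≤ c₂ := by rw [hc₂]; positivity
  obtain ⟨κ, hκ⟩ : ∃ κ, κ = Λ ^ 2 * c₁ + 2 * c₂ * Λ ^ 2 * (c₁ + 1) := ⟨_, rfl⟩
  have hκ0 : 0 ≤ κ := by rw [hκ]; positivity
  have hden : 0 < 4 * (κ / η₂ + Λ / 2) + 1 := by positivity
  -- For such steps the errors cost at most half of the descent `γ η₁ / 2 * a²`; also `γ ≤ 1`,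
  -- because `η₁ ≤ 1`.
  refine ⟨η₁ / (4 * (κ / η₂ + Λ / 2) + 1), by positivity, ?_⟩
  intro n f hf hL hbdd x₀ γ hγ hγbar
  rw [le_div_iff₀ hden] at hγbar
  have hγ1 : γ ≤ 1 := by
    have : 0 ≤ γ * (4 * (κ / η₂ + Λ / 2)) := by positivity
    linarith
  have hγκ : (κ / η₂ + Λ / 2) * γ ≤ η₁ / 4 := by linarith
  obtain ⟨b, hb⟩ := hbdd
  have hFL : ∀ x y, ‖gradient (AsySonata.total f) x - gradient (AsySonata.total f) y‖
      ≤ Λ * ‖x - y‖ := by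
    intro x y
    rw [norm_sub_rev, norm_sub_rev x, AsySonata.gradient_total hf x, norm_sub_rev y]
    exact AsySonata.norm_gradient_total_sub_le hf hL fun _ => le_rfl
  have hFd : Differentiable ℝ (AsySonata.total f) := by
    unfold AsySonata.total
    exact Differentiable.fun_sum fun i _ => hf i
  have hquad := AsySonata.le_quadratic_of_lipschitz_gradient hFd hFL
  set F := AsySonata.total f with hFdef
  set S₀ := ∑ i, ‖x₀ i‖
  set B₀ := ∑ i, ‖gradient (f i) (x₀ i)‖
  have hS₀ : 0 ≤ S₀ := sum_nonneg fun _ _ => norm_nonneg _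
  obtain ⟨P, hP⟩ : ∃ P, P = (Λ ^ 2 * c₁ + 2 * c₂ * Λ ^ 2 * c₁) * S₀ ^ 2 + c₂ * B₀ ^ 2 := ⟨_, rfl⟩
  -- `B` bounds `F - b` on the ball of radius `S₀`, where the mean point starts.
  obtain ⟨B, hB⟩ : ∃ B, B = F 0 + ‖gradient F 0‖ * S₀ + Λ / 2 * S₀ ^ 2 - b := ⟨_, rfl⟩
  -- `Abar` will bound the sum of the squares of `‖z‖` over the active agents.
  obtain ⟨Abar, hAb⟩ : ∃ Abar, Abar = 4 * (B + γ * P / η₂) / (γ * η₁) := ⟨_, rfl⟩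
  refine ⟨(3 * Λ ^ 2 + Fintype.card V) * (c₁ * (S₀ ^ 2 + γ ^ 2 * Abar))
    + 3 / η₂ ^ 2 * (Abar + (P + κ * γ ^ 2 * Abar)), ?_⟩
  intro W A act d s hW hWs hAc hAs hA h δ hδ
  obtain ⟨hx, hstep, hmean⟩ := hcons hW hWs hA hγ.le h
  choose ξ hξ0 hξ1 hξ using htrack hAc hAs hA h
  set a : ℕ → ℝ := fun k => ‖s.z k (act k)‖ with ha
  set ε : ℕ → ℝ := fun k => ‖AsySonata.gradInc f act s k‖ with hε
  set σ := AsySonata.fading C₁ ρ₁ S₀ (fun l => γ * a l) with hσ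
  set t := AsySonata.fading C₂ ρ₂ B₀ ε with ht
  refine AsySonata.exists_isLeast_le_div (fun N => ?_) hδ
  have hε' : ∀ k, ε k ^ 2 ≤ 2 * Λ ^ 2 * (σ k ^ 2 + (γ * a k) ^ 2) := by
    intro k
    have h1 : ε k ≤ Λ * (σ k + γ * a k) :=
      ((hL (act k)).norm_sub_le _ _).trans (mul_le_mul
        (single_le_sum (f := fun i => (L i : ℝ)) (fun i _ => (L i).2) (mem_univ _)) (hstep k)
        (norm_nonneg _) hΛ)
    have h2 := pow_le_pow_left₀ (norm_nonneg _) h1 2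
    nlinarith [mul_nonneg (sq_nonneg Λ) (sq_nonneg (σ k - γ * a k))]
  have hsum : ∑ k ∈ range N, (γ * a k) ^ 2 = γ ^ 2 * ∑ k ∈ range N, a k ^ 2 := by
    simp only [mul_pow, mul_sum]
  have hSσ := AsySonata.sum_fading_sq_le (C := C₁) hρ₁ hρ₁' S₀ (fun l => γ * a l) N
  rw [← hc₁, hsum] at hSσ
  have hSt := AsySonata.sum_fading_sq_le (C := C₂) hρ₂ hρ₂' B₀ ε N
  rw [← hc₂] at hSt
  have hSε : ∑ k ∈ range N, ε k ^ 2
      ≤ 2 * Λ ^ 2 * (∑ k ∈ range N, σ k ^ 2 + γ ^ 2 * ∑ k ∈ range N, a k ^ 2) := by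
    rw [← hsum, ← sum_add_distrib, mul_sum]
    exact sum_le_sum fun k _ => hε' k
  obtain ⟨q, w, hw, hq, hxw, hw0⟩ := hmean N
  have hdesc : ∀ k < N, F (w (k + 1)) ≤ F (w k) - γ * η₁ / 2 * a k ^ 2
      + γ / η₂ * (Λ ^ 2 * σ k ^ 2 + t k ^ 2) + Λ / 2 * γ ^ 2 * a k ^ 2 := by
    intro k hk
    have := AsySonata.descent_step (hquad (w k)) hΛ hγ.le hη₁ hη₂ (hq k hk).1 (hq k hk).2 (hξ0 k)
      (hξ1 k) (AsySonata.norm_gradient_total_sub_le hf hL (hxw k)) (hξ k)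
    rwa [mul_pow, ← hw k hk] at this
  have hSdesc : 0 ≤ B - γ * η₁ / 2 * ∑ k ∈ range N, a k ^ 2
      + γ / η₂ * (Λ ^ 2 * ∑ k ∈ range N, σ k ^ 2 + ∑ k ∈ range N, t k ^ 2)
      + Λ / 2 * γ ^ 2 * ∑ k ∈ range N, a k ^ 2 := by
    have h1 : ∑ k ∈ range N, (F (w (k + 1)) - F (w k)) ≤
        ∑ k ∈ range N, (-(γ * η₁ / 2 * a k ^ 2)
          + γ / η₂ * (Λ ^ 2 * σ k ^ 2 + t k ^ 2) + Λ / 2 * γ ^ 2 * a k ^ 2) :=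
      sum_le_sum fun k hk => by linarith [hdesc k (mem_range.1 hk)]
    rw [sum_range_sub (fun k => F (w k))] at h1
    simp only [sum_add_distrib, sum_neg_distrib, ← mul_sum] at h1
    have h2 : b ≤ F (w N) := hb ⟨w N, rfl⟩
    have h3 := hquad 0 (w 0)
    rw [zero_add] at h3
    have h4 := (real_inner_le_norm (gradient F 0) (w 0)).trans
      (mul_le_mul_of_nonneg_left hw0 (norm_nonneg _))
    have h5 := mul_le_mul_of_nonneg_left (pow_le_pow_left₀ (norm_nonneg _) hw0 2)
      (show 0 ≤ Λ / 2 by positivity)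
    rw [hB]
    linarith
  obtain ⟨hA1, hA2⟩ := AsySonata.energy_bound hη₁ hη₂ hγ hγ1 hc₁0 hc₂0
    (sum_nonneg fun k _ => sq_nonneg (a k)) hκ hP hγκ hSσ hSε hSt hSdesc
  rw [← hAb] at hA1
  have hmerit : ∀ k, AsySonata.merit f (s.x k)
      ≤ (3 * Λ ^ 2 + Fintype.card V) * σ k ^ 2 + 3 / η₂ ^ 2 * (a k ^ 2 + t k ^ 2) :=
    fun k => AsySonata.merit_le hf hL hη₂ (hξ0 k) (hx k) (hξ k)
  have hSA0 : 0 ≤ ∑ k ∈ range N, a k ^ 2 := sum_nonneg fun k _ => sq_nonneg _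
  have hσ' : ∑ k ∈ range N, σ k ^ 2 ≤ c₁ * (S₀ ^ 2 + γ ^ 2 * Abar) :=
    hSσ.trans (by gcongr)
  have hσ0 : 0 ≤ ∑ k ∈ range N, σ k ^ 2 := sum_nonneg fun k _ => sq_nonneg _
  have ht' : ∑ k ∈ range N, t k ^ 2 ≤ P + κ * γ ^ 2 * Abar := by
    have h1 : κ * γ ^ 2 * ∑ k ∈ range N, a k ^ 2 ≤ κ * γ ^ 2 * Abar := by gcongr
    have h2 := mul_nonneg (sq_nonneg Λ) hσ0
    linarith
  calc ∑ k ∈ range N, AsySonata.merit f (s.x k)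
      ≤ ∑ k ∈ range N, ((3 * Λ ^ 2 + Fintype.card V) * σ k ^ 2
        + 3 / η₂ ^ 2 * (a k ^ 2 + t k ^ 2)) := sum_le_sum fun k _ => hmerit k
    _ = (3 * Λ ^ 2 + Fintype.card V) * ∑ k ∈ range N, σ k ^ 2
        + 3 / η₂ ^ 2 * (∑ k ∈ range N, a k ^ 2 + ∑ k ∈ range N, t k ^ 2) := by
      simp only [sum_add_distrib, ← mul_sum]
    _ ≤ _ := by gcongr
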